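/- **Setting.** Let $S$ be a finite non-empty set, $\mathcal F\subseteq 2^S$, $F^*\in\mathcal F$, $c\in\mathbb R^S$, $w\in\mathbb R_{>0}^S$ with $1/w(s)\in\mathbb Z$ for every $s\in S$, and $\ell:S\to\mathbb R\cup\{-\infty\}$, $u:S\to\mathbb R\cup\{+\infty\}$ with $\ell\le u$. Write $c(F)=\sum_{s\in F}c(s)$ and $\|w\|_{-1}=\sum_{s\in S}1/w(s)$. A vector $p\in\mathbb R^S$ is a *feasible deviation vector* if $F^*$ is a minimum-cost member of $\mathcal F$ with respect to $c-p$ and $\ell\le p\le u$; it is *optimal* if moreover $\mathrm{span}_w(p)=\max_{s\in S} w(s)p(s)-\min_{s\in S} w(s)p(s)$ is minimum among all feasible deviation vectors. The instance is *infeasible* if there is no feasible deviation vector. For $\delta,\Delta\in\mathbb R$ let $p_{\delta,\Delta}(s)$ be the value $(\delta+\Delta)/w(s)$ if $s\in F^*$ and $\Delta/w(s)$ if $s\notin F^*$, truncated to $[\ell(s),u(s)]$. An *oracle* $\mathcal O$ returns, for every cost function $c'\in\mathbb R^S$, a minimum $c'$-cost member of $\mathcal F$. **(SPEC-LU).** There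 are $S_0\subseteq S$, $\ell^{\rm in},\ell^{\rm out}\in\mathbb R\cup\{-\infty\}$, $u^{\rm in},u^{\rm out}\in\mathbb R\cup\{+\infty\}$ such that $\ell(s)=u(s)=0$ for $s\in S_0$; $\ell(s)=\ell^{\rm in}/w(s)$, $u(s)=u^{\rm in}/w(s)$ for $s\in F^*\setminus S_0$; $\ell(s)=\ell^{\rm out}/w(s)$, $u(s)=u^{\rm out}/w(s)$ for all other $s$; $\ell^{\rm in}\le u^{\rm in}$, $\ell^{\rm out}\le u^{\rm out}$, $\ell^{\rm out}\le\ell^{\rm in}$, $u^{\rm out}\le u^{\rm in}$; and $u^{\rm out}\le 0\le\ell^{\rm in}$ if $S_0\ne\emptyset$. **Notation.** $\mu(X)=\sum_{s\in X\setminus S_0}1/w(s)$. For a current cost function $c'$ and current $d,D$ put $\gamma(F)=c'(F^*)-c'(F)$, $a(F)=\mu(F^*)-\mu(F)$, $\alpha(F)=\mu(F^*\setminus F)$, $\beta(F)=\mu(F\setminus F^*)$, and $f_1(F)=\frac{\gamma(F)}{\alpha(F)}$, $f_2(F)=u^{\rm in}-d-D-\frac{\gamma(F)}{\alpha(F)}$,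 $f_3(F)=\frac{\gamma(F)}{a(F)}$, $f_4(F)=\frac{-\gamma(F)+(u^{\rm in}-d-D)\alpha(F)}{\beta(F)}$, $f_5(F)=\frac{\gamma(F)-(u^{\rm in}-d-D)a(F)}{\beta(F)}$, $f_6(F)=\frac{\gamma(F)-(u^{\rm out}-D)a(F)}{\alpha(F)}$, $f_7(X,Z)=\Big(\frac{\gamma(X)}{a(X)}-\frac{\gamma(Z)}{a(Z)}\Big)\Big/\Big(\frac{\alpha(X)}{a(X)}-\frac{\alpha(Z)}{a(Z)}\Big)$, $f_8(X,Z)=\frac{\gamma(X)-f_7(X,Z)\alpha(X)}{a(X)}$, $f_9(F)=\frac{\gamma(F)-(\ell^{\rm out}-D)a(F)}{\alpha(F)}$, $f_{10}(F)=\frac{-\gamma(F)+(\ell^{\rm in}-d-D)\alpha(F)}{\beta(F)}$, $f_{11}(F)=\frac{\gamma(F)-(\ell^{\rm in}-d-D)a(F)}{\beta(F)}$, $f_{12}(X,Z)=\frac{\gamma(Z)-f_7(X,Z)\alpha(Z)}{a(Z)}$. **Algorithm 1.** Start with $d=\max\{\ell^{\rm in}-u^{\rm out},0\}$; $D=u^{\rm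 out}$ if $u^{\rm out}\ne+\infty$, otherwise $D=\ell^{\rm in}$ if $\ell^{\rm in}\ne-\infty$, otherwise $D=0$; and $X,Y,Z$ undefined ($\ast$). Repeat: let $c'=c-p_{d,D}$ and let $F$ be the answer of $\mathcal O$ to $c'$ (one oracle call). If $c'(F^*)\le c'(F)$, return $p_{d,D}$. Otherwise determine $\delta,\Delta$ and the new $X,Y,Z$ as follows, and replace $(d,D)$ by $(d+\delta,D+\Delta)$; sets not mentioned keep their value. Two sub-rules are used. RAISE: if $F\setminus S_0\not\subseteq F^*\setminus S_0$ and $D+f_4(F)\ge\ell^{\rm out}$, then $(\delta,\Delta)=(f_5(F),f_4(F))$; else return Infeasible. LOWER: if $F^*\setminus S_0\not\subseteq F\setminus S_0$ and $d+f_9(F)\le u^{\rm in}-\ell^{\rm out}$, then $(\delta,\Delta)=(f_9(F),\ell^{\rm out}-D)$; else return Infeasible. 1. $\mu(F)=\mu(F^*)$. If $F\setminus S_0=F^*\setminus S_0$, return Infeasible. Otherwise set $X=Z=\ast$, $Y=F$. If $d+D+f_1(F)\le u^{\rm in}$: $(\delta,\Delta)=(f_1(F),0)$. Else if $D+f_2(F)\ge\ell^{\rm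 out}$: $(\delta,\Delta)=(f_1(F),f_2(F))$. Else return Infeasible. 2. $\mu(F)<\mu(F^*)$, $Z=\ast$. Set $X=F$. If $D+f_3(F)\le u^{\rm out}$: if $d+D+f_3(F)\le u^{\rm in}$ then $(\delta,\Delta)=(0,f_3(F))$, else RAISE. If $D+f_3(F)>u^{\rm out}$: if $d+f_6(F)\le u^{\rm in}-u^{\rm out}$ then $(\delta,\Delta)=(f_6(F),u^{\rm out}-D)$, else RAISE. 3. $\mu(F)<\mu(F^*)$, $Z\ne\ast$. Set $X=F$. If $D+f_8(F,Z)\le u^{\rm out}$: if $d+D+f_7(F,Z)+f_8(F,Z)\le u^{\rm in}$ then $(\delta,\Delta)=(f_7(F,Z),f_8(F,Z))$, else set $Z=\ast$ and RAISE. If $D+f_8(F,Z)>u^{\rm out}$: set $Z=\ast$; if $d+f_6(F)\le u^{\rm in}-u^{\rm out}$ then $(\delta,\Delta)=(f_6(F),u^{\rm out}-D)$, else RAISE. 4. $\mu(F)>\mu(F^*)$, $X=\ast$. Set $Z=F$. If $d+D+f_3(F)\ge\ell^{\rm in}$: if $D+f_3(F)\ge\ell^{\rm out}$ then $(\delta,\Delta)=(0,f_3(F))$,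 else LOWER. If $d+D+f_3(F)<\ell^{\rm in}$: if $D+f_{10}(F)\ge\ell^{\rm out}$ then $(\delta,\Delta)=(f_{11}(F),f_{10}(F))$, else LOWER. 5. $\mu(F)>\mu(F^*)$, $X\ne\ast$. Set $Z=F$. If $d+D+f_7(X,F)+f_{12}(X,F)\ge\ell^{\rm in}$: if $D+f_{12}(X,F)\ge\ell^{\rm out}$ then $(\delta,\Delta)=(f_7(X,F),f_{12}(X,F))$, else set $X=\ast$ and LOWER. If $d+D+f_7(X,F)+f_{12}(X,F)<\ell^{\rm in}$: set $X=\ast$; if $D+f_{10}(F)\ge\ell^{\rm out}$ then $(\delta,\Delta)=(f_{11}(F),f_{10}(F))$, else LOWER. **Theorem.** There is an absolute constant $C$ such that for every instance as above satisfying (SPEC-LU), and every oracle $\mathcal O$ for it, Algorithm 1 terminates after at most $C\cdot\|w\|_{-1}^6$ calls to $\mathcal O$. If it returns a vector, this vector is an optimal deviation vector and is of the form $p_{d,D}$ with $d,D\in\mathbb R$; if it returns Infeasible, then the instance is infeasible. -/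

import Mathlib

open Finset

namespace InvSpan

noncomputable section

variable {S : Type*} [Fintype S] [DecidableEq S]

/-- The cost `c(F) = ∑_{s ∈ F} c(s)` of a set `F`. -/
def cost (c : S → ℝ) (F : Finset S) : ℝ := ∑ s ∈ F, c s

/-- The weighted span `max_s w(s) p(s) - min_s w(s) p(s)`. -/
def wspan [Nonempty S] (w p : S → ℝ) : ℝ :=
  univ.sup' univ_nonempty (fun s => w s * p s) - univ.inf' univ_nonempty (fun s => w s * p s)

/-- A constrained minimum-cost inverse optimization problem: a family `𝓕` of feasible solutions on
the ground set `S`, an input solution `Fs` (written `F*`), a cost function `c`, positive weights `w`,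
and bounds `ℓ : S → ℝ ∪ {-∞}`, `u : S → ℝ ∪ {+∞}` with `ℓ ≤ u`. -/
structure Problem (S : Type*) where
  𝓕 : Set (Finset S)
  Fs : Finset S
  Fs_mem : Fs ∈ 𝓕
  c : S → ℝ
  w : S → ℝ
  w_pos : ∀ s, 0 < w s
  ℓ : S → EReal
  u : S → EReal
  ℓ_ne_top : ∀ s, ℓ s ≠ ⊤
  u_ne_bot : ∀ s, u s ≠ ⊥
  ℓ_le_u : ∀ s, ℓ s ≤ u s

/-- `p` is a feasible deviation vector: `F*` is a minimum-cost member of `𝓕` with respect to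
`c - p`, and `ℓ ≤ p ≤ u`. -/
def Problem.IsFeasible (P : Problem S) (p : S → ℝ) : Prop :=
  (∀ F ∈ P.𝓕, cost (P.c - p) P.Fs ≤ cost (P.c - p) F) ∧
  ∀ s, P.ℓ s ≤ (p s : EReal) ∧ (p s : EReal) ≤ P.u s

/-- `p` is an optimal deviation vector: a feasible one of minimum weighted span. -/
def Problem.IsOptimal [Nonempty S] (P : Problem S) (p : S → ℝ) : Prop :=
  P.IsFeasible p ∧ ∀ q, P.IsFeasible q → wspan P.w p ≤ wspan P.w q

/-- `‖w‖₋₁ = ∑_{s ∈ S} 1 / w(s)`. -/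
def Problem.wNegOne (P : Problem S) : ℝ := ∑ s, 1 / P.w s

/-- The weights are scaled so that `1 / w(s)` is an integer for every `s`. -/
def Problem.IntegralWeights (P : Problem S) : Prop := ∀ s, ∃ n : ℕ, 1 / P.w s = n

/-- An oracle for the underlying optimization problem: for every cost function it returns a
minimum-cost member of `𝓕`. -/
def Problem.IsOracle (P : Problem S) (O : (S → ℝ) → Finset S) : Prop :=
  ∀ c' : S → ℝ, O c' ∈ P.𝓕 ∧ ∀ F ∈ P.𝓕, cost c' (O c') ≤ cost c' F

/-- The deviation vector `p_{δ,Δ}`: it takes the value `(δ + Δ) / w(s)` on `F*` and `Δ / w(s)` off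
`F*`, truncated to the interval `[ℓ(s), u(s)]`. -/
def Problem.dev (P : Problem S) (δ Δ : ℝ) (s : S) : ℝ :=
  let t : ℝ := if s ∈ P.Fs then (δ + Δ) / P.w s else Δ / P.w s
  if (t : EReal) < P.ℓ s then (P.ℓ s).toReal
  else if P.u s < (t : EReal) then (P.u s).toReal
  else t

/-- The parameters of bound constraints of the special form (SPEC-LU). -/
structure Spec (S : Type*) where
  S₀ : Finset S
  ℓin : EReal
  ℓout : EReal
  uin : EReal
  uout : EReal

/-- The bound constraints of `P` have the special form (SPEC-LU) with parameters `B`. -/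
structure Problem.IsSpecLU (P : Problem S) (B : Spec S) : Prop where
  ℓin_ne_top : B.ℓin ≠ ⊤
  ℓout_ne_top : B.ℓout ≠ ⊤
  uin_ne_bot : B.uin ≠ ⊥
  uout_ne_bot : B.uout ≠ ⊥
  ℓ_eq : ∀ s, P.ℓ s =
    if s ∈ B.S₀ then 0 else if s ∈ P.Fs then B.ℓin / (P.w s : EReal) else B.ℓout / (P.w s : EReal)
  u_eq : ∀ s, P.u s =
    if s ∈ B.S₀ then 0 else if s ∈ P.Fs then B.uin / (P.w s : EReal) else B.uout / (P.w s : EReal)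
  in_le : B.ℓin ≤ B.uin
  out_le : B.ℓout ≤ B.uout
  ℓout_le_ℓin : B.ℓout ≤ B.ℓin
  uout_le_uin : B.uout ≤ B.uin
  ℓin_nonneg : B.S₀.Nonempty → 0 ≤ B.ℓin
  uout_nonpos : B.S₀.Nonempty → B.uout ≤ 0

section Algorithm

variable (P : Problem S) (B : Spec S)

/-- `μ(X) = ∑_{s ∈ X \ S₀} 1 / w(s)`. -/
def mu (X : Finset S) : ℝ := ∑ s ∈ X \ B.S₀, 1 / P.w s

/-! The update functions. The first argument `c` is the current cost function; `d`, `D` are the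
current parameters of the deviation vector. -/

def f1 (c : S → ℝ) (F : Finset S) : ℝ :=
  (cost c P.Fs - cost c F) / mu P B (P.Fs \ F)

def f2 (c : S → ℝ) (d D : ℝ) (F : Finset S) : ℝ :=
  B.uin.toReal - d - D - (cost c P.Fs - cost c F) / mu P B (P.Fs \ F)

def f3 (c : S → ℝ) (F : Finset S) : ℝ :=
  (cost c P.Fs - cost c F) / (mu P B P.Fs - mu P B F)

def f4 (c : S → ℝ) (d D : ℝ) (F : Finset S) : ℝ :=
  (cost c F - cost c P.Fs + (B.uin.toReal - d - D) * mu P B (P.Fs \ F)) / mu P B (F \ P.Fs)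

def f5 (c : S → ℝ) (d D : ℝ) (F : Finset S) : ℝ :=
  (cost c P.Fs - cost c F - (B.uin.toReal - d - D) * (mu P B P.Fs - mu P B F)) /
    mu P B (F \ P.Fs)

def f6 (c : S → ℝ) (D : ℝ) (F : Finset S) : ℝ :=
  (cost c P.Fs - cost c F - (B.uout.toReal - D) * (mu P B P.Fs - mu P B F)) /
    mu P B (P.Fs \ F)

def f7 (c : S → ℝ) (X Z : Finset S) : ℝ :=
  ((cost c P.Fs - cost c X) / (mu P B P.Fs - mu P B X) -
      (cost c P.Fs - cost c Z) / (mu P B P.Fs - mu P B Z)) /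
    (mu P B (P.Fs \ X) / (mu P B P.Fs - mu P B X) -
      mu P B (P.Fs \ Z) / (mu P B P.Fs - mu P B Z))

def f8 (c : S → ℝ) (X Z : Finset S) : ℝ :=
  (cost c P.Fs - cost c X - f7 P B c X Z * mu P B (P.Fs \ X)) / (mu P B P.Fs - mu P B X)

def f9 (c : S → ℝ) (D : ℝ) (F : Finset S) : ℝ :=
  (cost c P.Fs - cost c F - (B.ℓout.toReal - D) * (mu P B P.Fs - mu P B F)) /
    mu P B (P.Fs \ F)

def f10 (c : S → ℝ) (d D : ℝ) (F : Finset S) : ℝ :=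
  (cost c F - cost c P.Fs + (B.ℓin.toReal - d - D) * mu P B (P.Fs \ F)) / mu P B (F \ P.Fs)

def f11 (c : S → ℝ) (d D : ℝ) (F : Finset S) : ℝ :=
  (cost c P.Fs - cost c F - (B.ℓin.toReal - d - D) * (mu P B P.Fs - mu P B F)) /
    mu P B (F \ P.Fs)

def f12 (c : S → ℝ) (X Z : Finset S) : ℝ :=
  (cost c P.Fs - cost c Z - f7 P B c X Z * mu P B (P.Fs \ Z)) / (mu P B P.Fs - mu P B Z)

/-- The state at the beginning of an iteration: the parameters `d`, `D` of the current deviation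
vector, the recorded sets `X`, `Y`, `Z` (`none` stands for an undefined set), the answer `F` of the
oracle to the current cost function, and the number `calls` of oracle calls made so far. -/
structure State (S : Type*) where
  d : ℝ
  D : ℝ
  X : Option (Finset S)
  Y : Option (Finset S)
  Z : Option (Finset S)
  F : Finset S
  calls : ℕ

/-- The values assigned by one iteration: the new recorded sets and the increments `δ`, `Δ`. -/
structure Update (S : Type*) where
  X : Option (Finset S)
  Y : Option (Finset S)
  Z : Option (Finset S)
  δ : ℝ
  Δ : ℝ

/-- The current cost function `c - p_{d,D}`. -/
def State.cur (σ : State S) : S → ℝ := P.c - P.dev σ.d σ.D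

/-! In the following case distinctions `none` means that `Infeasible` is returned. -/

/-- The innermost branch shared by Cases 2 and 3: eliminate `F` with `F*` moved to its upper
bound. -/
def raise (σ : State S) (X Y Z : Option (Finset S)) : Option (Update S) :=
  if ¬ σ.F \ B.S₀ ⊆ P.Fs \ B.S₀ ∧
      B.ℓout ≤ ((σ.D + f4 P B (σ.cur P) σ.d σ.D σ.F : ℝ) : EReal) then
    some ⟨X, Y, Z, f5 P B (σ.cur P) σ.d σ.D σ.F, f4 P B (σ.cur P) σ.d σ.D σ.F⟩
  else none

/-- The innermost branch shared by Cases 4 and 5: eliminate `F` with `S \ F*` moved to its lower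
bound. -/
def lower (σ : State S) (X Y Z : Option (Finset S)) : Option (Update S) :=
  if ¬ P.Fs \ B.S₀ ⊆ σ.F \ B.S₀ ∧
      ((σ.d + f9 P B (σ.cur P) σ.D σ.F : ℝ) : EReal) ≤ B.uin - B.ℓout then
    some ⟨X, Y, Z, f9 P B (σ.cur P) σ.D σ.F, B.ℓout.toReal - σ.D⟩
  else none

/-- Case 1: `μ(F) = μ(F*)`. If `F \ S₀ = F* \ S₀`, the quotient defining `f₁` has denominator zero
(`F` and `F*` then differ only in elements on which every deviation vector vanishes, so `F` cannot
be eliminated); `Infeasible` is returned. -/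
def case1 (σ : State S) : Option (Update S) :=
  if σ.F \ B.S₀ = P.Fs \ B.S₀ then none
  else if ((σ.d + σ.D + f1 P B (σ.cur P) σ.F : ℝ) : EReal) ≤ B.uin then
    some ⟨none, some σ.F, none, f1 P B (σ.cur P) σ.F, 0⟩
  else if B.ℓout ≤ ((σ.D + f2 P B (σ.cur P) σ.d σ.D σ.F : ℝ) : EReal) then
    some ⟨none, some σ.F, none, f1 P B (σ.cur P) σ.F, f2 P B (σ.cur P) σ.d σ.D σ.F⟩
  else none

/-- Case 2: `μ(F) < μ(F*)` and `Z` is undefined. -/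
def case2 (σ : State S) : Option (Update S) :=
  if ((σ.D + f3 P B (σ.cur P) σ.F : ℝ) : EReal) ≤ B.uout then
    if ((σ.d + σ.D + f3 P B (σ.cur P) σ.F : ℝ) : EReal) ≤ B.uin then
      some ⟨some σ.F, σ.Y, σ.Z, 0, f3 P B (σ.cur P) σ.F⟩
    else raise P B σ (some σ.F) σ.Y σ.Z
  else if ((σ.d + f6 P B (σ.cur P) σ.D σ.F : ℝ) : EReal) ≤ B.uin - B.uout then
    some ⟨some σ.F, σ.Y, σ.Z, f6 P B (σ.cur P) σ.D σ.F, B.uout.toReal - σ.D⟩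
  else raise P B σ (some σ.F) σ.Y σ.Z

/-- Case 3: `μ(F) < μ(F*)` and `Z` is defined. -/
def case3 (σ : State S) (Z : Finset S) : Option (Update S) :=
  if ((σ.D + f8 P B (σ.cur P) σ.F Z : ℝ) : EReal) ≤ B.uout then
    if ((σ.d + σ.D + f7 P B (σ.cur P) σ.F Z + f8 P B (σ.cur P) σ.F Z : ℝ) : EReal) ≤ B.uin then
      some ⟨some σ.F, σ.Y, some Z, f7 P B (σ.cur P) σ.F Z, f8 P B (σ.cur P) σ.F Z⟩
    else raise P B σ (some σ.F) σ.Y none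
  else if ((σ.d + f6 P B (σ.cur P) σ.D σ.F : ℝ) : EReal) ≤ B.uin - B.uout then
    some ⟨some σ.F, σ.Y, none, f6 P B (σ.cur P) σ.D σ.F, B.uout.toReal - σ.D⟩
  else raise P B σ (some σ.F) σ.Y none

/-- Case 4: `μ(F) > μ(F*)` and `X` is undefined. -/
def case4 (σ : State S) : Option (Update S) :=
  if B.ℓin ≤ ((σ.d + σ.D + f3 P B (σ.cur P) σ.F : ℝ) : EReal) then
    if B.ℓout ≤ ((σ.D + f3 P B (σ.cur P) σ.F : ℝ) : EReal) then
      some ⟨σ.X, σ.Y, some σ.F, 0, f3 P B (σ.cur P) σ.F⟩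
    else lower P B σ σ.X σ.Y (some σ.F)
  else if B.ℓout ≤ ((σ.D + f10 P B (σ.cur P) σ.d σ.D σ.F : ℝ) : EReal) then
    some ⟨σ.X, σ.Y, some σ.F, f11 P B (σ.cur P) σ.d σ.D σ.F, f10 P B (σ.cur P) σ.d σ.D σ.F⟩
  else lower P B σ σ.X σ.Y (some σ.F)

/-- Case 5: `μ(F) > μ(F*)` and `X` is defined. -/
def case5 (σ : State S) (X : Finset S) : Option (Update S) :=
  if B.ℓin ≤ ((σ.d + σ.D + f7 P B (σ.cur P) X σ.F + f12 P B (σ.cur P) X σ.F : ℝ) : EReal) then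
    if B.ℓout ≤ ((σ.D + f12 P B (σ.cur P) X σ.F : ℝ) : EReal) then
      some ⟨some X, σ.Y, some σ.F, f7 P B (σ.cur P) X σ.F, f12 P B (σ.cur P) X σ.F⟩
    else lower P B σ none σ.Y (some σ.F)
  else if B.ℓout ≤ ((σ.D + f10 P B (σ.cur P) σ.d σ.D σ.F : ℝ) : EReal) then
    some ⟨none, σ.Y, some σ.F, f11 P B (σ.cur P) σ.d σ.D σ.F, f10 P B (σ.cur P) σ.d σ.D σ.F⟩
  else lower P B σ none σ.Y (some σ.F)

/-- The case distinction in the body of the while loop. -/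
def body (σ : State S) : Option (Update S) :=
  if mu P B σ.F = mu P B P.Fs then case1 P B σ
  else if mu P B σ.F < mu P B P.Fs then
    match σ.Z with
    | none => case2 P B σ
    | some Z => case3 P B σ Z
  else
    match σ.X with
    | none => case4 P B σ
    | some X => case5 P B σ X

/-- What the algorithm returns. -/
inductive Outcome (S : Type*) where
  | infeasible : Outcome S
  | vector (p : S → ℝ) : Outcome S

/-- The algorithm is either at the beginning of an iteration, or it has returned an outcome after a
total number `calls` of oracle calls. -/
inductive Config (S : Type*) where
  | running (σ : State S) : Config S
  | halted (o : Outcome S) (calls : ℕ) : Config S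

variable (O : (S → ℝ) → Finset S)

/-- Enter an iteration with the parameters `d`, `D` and the recorded sets `X`, `Y`, `Z`, which costs
one oracle call, `calls` being the number of calls made before. -/
def enter (d D : ℝ) (X Y Z : Option (Finset S)) (calls : ℕ) : Config S :=
  .running ⟨d, D, X, Y, Z, O (P.c - P.dev d D), calls + 1⟩

/-- The initial value `max {ℓ^in - u^out, 0}` of `d`. -/
def d₀ : ℝ := (max (B.ℓin - B.uout) 0).toReal

/-- The initial value of `D`. -/
def D₀ : ℝ := if B.uout ≠ ⊤ then B.uout.toReal else if B.ℓin ≠ ⊥ then B.ℓin.toReal else 0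

/-- Initialization. -/
def init : Config S := enter P O (d₀ B) (D₀ B) none none none 0

/-- One evaluation of the loop condition, followed by one iteration or by the return of a result. -/
def next : Config S → Config S
  | .halted o k => .halted o k
  | .running σ =>
    if cost (σ.cur P) σ.F < cost (σ.cur P) P.Fs then
      match body P B σ with
      | none => .halted .infeasible σ.calls
      | some U => enter P O (σ.d + U.δ) (σ.D + U.Δ) U.X U.Y U.Z σ.calls
    else .halted (.vector (P.dev σ.d σ.D)) σ.calls

/-- The algorithm terminates, returns `o`, and makes exactly `N` calls to the oracle `O`. -/
def Returns (o : Outcome S) (N : ℕ) : Prop :=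
  ∃ n : ℕ, (next P B O)^[n] (init P B O) = .halted o N

end Algorithm

end

end InvSpan

/-! Outside `B.S₀`, take the largest weighted value of a feasible vector on `P.Fs` and the smallest
one off it. These two numbers, read as `x + y` and `y`, again satisfy all constraints, so the
problem becomes a planar one: minimize `max x 0` over the half-planes `gap F ≤ x * al F + y * (al F
- be F)` and the four bounds (`Problem.IsFeasible.exists_feasPair`, `isOptimal_dev`).

The loop keeps an admissible point `(d, D)` whose `d` is at most `max x 0` for every feasible pair,
so a point violating nothing is optimal. An iteration moves onto the line of the violated
constraint: vertically, or to its intersection with a bound line or with the line of a recorded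
tight set whose `al - be` has the opposite sign. Combining the two constraints so that `y`
disappears shows that `d` remains a lower bound; if no admissible target exists, the same
constraints contradict each other (`body_ok`).

For the count, call the sets with given `al` and `be` a class; there are at most `(W + 1) ^ 2`
classes, where `W = P.wNegOne`. The oracle maximizes the violation, hence the gap within a class. So
whenever `d` grows, it reaches the greatest value available to some class with a bound, or to some
pair of classes, and that index is used up: `O(W ^ 4)` increases. While `d` is constant, `D` moves
in one direction only and uses up one class per step: `O(W ^ 2)` steps. `StepOK.potential_lt` merges
both counts into one potential. -/

namespace InvSpan

/-! ### Constraints as half-planes in the two parameters. -/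

section Basics

variable {S : Type*} [DecidableEq S] (P : Problem S) (B : Spec S)

/-- `α(F) = μ(F* \ F)`. -/
noncomputable def al (F : Finset S) : ℝ := mu P B (P.Fs \ F)

/-- `β(F) = μ(F \ F*)`. -/
noncomputable def be (F : Finset S) : ℝ := mu P B (F \ P.Fs)

/-- `c(F*) - c(F)` for the original cost function `c`. -/
noncomputable def gap (F : Finset S) : ℝ := cost P.c P.Fs - cost P.c F

/-- The weight with respect to which `μ` is a plain sum. -/
noncomputable def wt (s : S) : ℝ := if s ∈ B.S₀ then 0 else 1 / P.w s

/-- The bound constraints on a pair of parameters of a deviation vector. -/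
structure InBounds (B : Spec S) (x y : ℝ) : Prop where
  lin : B.ℓin ≤ ((x + y : ℝ) : EReal)
  uin : ((x + y : ℝ) : EReal) ≤ B.uin
  lout : B.ℓout ≤ (y : EReal)
  uout : (y : EReal) ≤ B.uout

/-- The parameters of a feasible deviation vector. -/
structure FeasPair (x y : ℝ) : Prop extends InBounds B x y where
  le : ∀ F ∈ P.𝓕, gap P F ≤ x * al P B F + y * (al P B F - be P B F)

/-- `F` has the largest gap among the members of `𝓕` with the same `α` and `β`. -/
structure IsClassMax (F : Finset S) : Prop where
  mem : F ∈ P.𝓕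
  le : ∀ F' ∈ P.𝓕, al P B F' = al P B F → be P B F' = be P B F → gap P F' ≤ gap P F

variable {P B}

theorem mu_eq_sum_wt (X : Finset S) : mu P B X = ∑ s ∈ X, wt P B s := by
  simp only [mu, wt, sdiff_eq_filter, sum_filter]
  exact sum_congr rfl fun s _ => by by_cases h : s ∈ B.S₀ <;> simp [h]

theorem wt_nonneg (s : S) : 0 ≤ wt P B s := by
  unfold wt
  split_ifs
  · exact le_rfl
  · exact (one_div_pos.2 (P.w_pos s)).le

theorem mu_sub_mu (F : Finset S) :
    mu P B P.Fs - mu P B F = al P B F - be P B F := by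
  simp only [al, be, mu_eq_sum_wt]
  exact (sum_sdiff_sub_sum_sdiff (f := wt P B)).symm

theorem mu_nonneg (X : Finset S) : 0 ≤ mu P B X := by
  rw [mu_eq_sum_wt]
  exact sum_nonneg fun s _ => wt_nonneg s

theorem al_nonneg (F : Finset S) : 0 ≤ al P B F := mu_nonneg _

theorem be_nonneg (F : Finset S) : 0 ≤ be P B F := mu_nonneg _

theorem mu_sdiff_eq_zero_iff (X Y : Finset S) :
    mu P B (X \ Y) = 0 ↔ X \ B.S₀ ⊆ Y \ B.S₀ := by
  rw [mu, sum_eq_zero_iff_of_nonneg fun s _ => (one_div_pos.2 (P.w_pos s)).le]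
  constructor
  · intro h s hs
    by_contra hY
    have h1 := h s (by grind)
    exact (one_div_pos.2 (P.w_pos s)).ne' h1
  · intro h s hs
    have := @h s (by grind)
    grind

theorem al_pos_iff (F : Finset S) : 0 < al P B F ↔ ¬ P.Fs \ B.S₀ ⊆ F \ B.S₀ := by
  rw [← mu_sdiff_eq_zero_iff (P := P), (al_nonneg F).lt_iff_ne']
  rfl

theorem be_pos_iff (F : Finset S) : 0 < be P B F ↔ ¬ F \ B.S₀ ⊆ P.Fs \ B.S₀ := by
  rw [← mu_sdiff_eq_zero_iff (P := P), (be_nonneg F).lt_iff_ne']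
  rfl

/-- Integrality confines `al` and `be` to `0, ..., W`, which is what makes the number of classes
polynomial. -/
theorem exists_nat_mu [Fintype S] (hW : P.IntegralWeights) :
    ∃ W : ℕ, P.wNegOne = W ∧ ∀ X : Finset S, ∃ n : ℕ, n ≤ W ∧ mu P B X = n := by
  choose n hn using hW
  refine ⟨∑ s, n s, by simp [Problem.wNegOne, hn], fun X => ⟨∑ s ∈ X \ B.S₀, n s, ?_, ?_⟩⟩
  · exact sum_le_sum_of_subset (subset_univ _)
  · simp [mu, hn]

omit [DecidableEq S] in
theorem one_le_wNegOne [Fintype S] [Nonempty S] (hW : P.IntegralWeights) : 1 ≤ P.wNegOne := by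
  obtain ⟨s⟩ := ‹Nonempty S›
  have h0 : ∀ t ∈ univ, 0 ≤ 1 / P.w t := fun t _ => (one_div_pos.2 (P.w_pos t)).le
  refine le_trans ?_ (single_le_sum h0 (mem_univ s))
  obtain ⟨n, hn⟩ := hW s
  have h1 := one_div_pos.2 (P.w_pos s)
  rw [hn] at h1 ⊢
  exact_mod_cast h1

theorem EReal_div_le_iff {x : EReal} {w t : ℝ} (hw : 0 < w) :
    x / (w : EReal) ≤ (t : EReal) ↔ x ≤ ((t * w : ℝ) : EReal) := by
  rw [EReal.div_le_iff_le_mul (by exact_mod_cast hw) (EReal.coe_ne_top _), EReal.coe_mul, mul_comm]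

theorem EReal_le_div_iff {x : EReal} {w t : ℝ} (hw : 0 < w) :
    (t : EReal) ≤ x / (w : EReal) ↔ ((t * w : ℝ) : EReal) ≤ x := by
  rw [EReal.le_div_iff_mul_le (by exact_mod_cast hw) (EReal.coe_ne_top _), EReal.coe_mul]

/-- The bound constraints on a deviation vector, in terms of the parameters. -/
theorem bounds_iff (hB : P.IsSpecLU B) (s : S) (t : ℝ) :
    (P.ℓ s ≤ (t : EReal) ∧ (t : EReal) ≤ P.u s) ↔
      if s ∈ B.S₀ then t = 0
      else if s ∈ P.Fs then B.ℓin ≤ ((t * P.w s : ℝ) : EReal) ∧ ((t * P.w s : ℝ) : EReal) ≤ B.uin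
      else B.ℓout ≤ ((t * P.w s : ℝ) : EReal) ∧ ((t * P.w s : ℝ) : EReal) ≤ B.uout := by
  rw [hB.ℓ_eq s, hB.u_eq s]
  split_ifs
  · rw [← EReal.coe_zero, EReal.coe_le_coe_iff, EReal.coe_le_coe_iff]
    exact ⟨fun h => le_antisymm h.2 h.1, fun h => by simp [h]⟩
  · rw [EReal_div_le_iff (P.w_pos s), EReal_le_div_iff (P.w_pos s)]
  · rw [EReal_div_le_iff (P.w_pos s), EReal_le_div_iff (P.w_pos s)]

/-- For admissible parameters truncation can act only on `B.S₀`, where it gives `0`, as does the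
factor `wt`. Hence the vector is linear in the parameters. -/
theorem dev_eq (hB : P.IsSpecLU B) {d D : ℝ} (h : InBounds B d D) (s : S) :
    P.dev d D s = (if s ∈ P.Fs then d + D else D) * wt P B s := by
  have hw := (P.w_pos s).ne'
  by_cases h0 : s ∈ B.S₀
  · have h1 := hB.ℓ_eq s
    have h2 := hB.u_eq s
    simp only [h0, if_true] at h1 h2
    simp only [Problem.dev, h1, h2, wt, h0, if_true, mul_zero, EReal.toReal_zero]
    split_ifs with h3 h4 h4 <;> first | rfl | skip
    all_goals
      rw [← EReal.coe_zero, EReal.coe_lt_coe_iff] at *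
      linarith
  · have key := (bounds_iff hB s (if s ∈ P.Fs then (d + D) / P.w s else D / P.w s)).2 (by
      simp only [h0, if_false]
      split_ifs
      · rw [div_mul_cancel₀ _ hw]
        exact ⟨h.lin, h.uin⟩
      · rw [div_mul_cancel₀ _ hw]
        exact ⟨h.lout, h.uout⟩)
    simp only [Problem.dev, not_lt.2 key.1, not_lt.2 key.2, if_false, wt, h0]
    split_ifs <;> ring

theorem dev_bounds (hB : P.IsSpecLU B) {d D : ℝ} (h : InBounds B d D) (s : S) :
    P.ℓ s ≤ (P.dev d D s : EReal) ∧ (P.dev d D s : EReal) ≤ P.u s := by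
  have hw := (P.w_pos s).ne'
  rw [bounds_iff hB, dev_eq hB h]
  by_cases h0 : s ∈ B.S₀
  · simp [wt, h0]
  · simp only [wt, h0, if_false, mul_assoc, one_div_mul_cancel hw, mul_one]
    split_ifs
    · exact ⟨h.lin, h.uin⟩
    · exact ⟨h.lout, h.uout⟩

theorem cost_sub_cost_sub (c p : S → ℝ) (G F : Finset S) :
    cost (c - p) G - cost (c - p) F =
      cost c G - cost c F - (∑ s ∈ G \ F, p s - ∑ s ∈ F \ G, p s) := by
  rw [sum_sdiff_sub_sum_sdiff]
  simp only [cost, Pi.sub_apply, sum_sub_distrib]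
  ring

/-- The current violation of the constraint of `F`. -/
theorem violation_eq (hB : P.IsSpecLU B) {d D : ℝ} (h : InBounds B d D) (F : Finset S) :
    cost (P.c - P.dev d D) P.Fs - cost (P.c - P.dev d D) F =
      gap P F - d * al P B F - D * (al P B F - be P B F) := by
  have h1 : ∑ s ∈ P.Fs \ F, P.dev d D s = (d + D) * al P B F := by
    rw [al, mu_eq_sum_wt, mul_sum]
    refine sum_congr rfl fun s hs => ?_
    rw [dev_eq hB h, if_pos (mem_sdiff.1 hs).1]
  have h2 : ∑ s ∈ F \ P.Fs, P.dev d D s = D * be P B F := by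
    rw [be, mu_eq_sum_wt, mul_sum]
    refine sum_congr rfl fun s hs => ?_
    rw [dev_eq hB h, if_neg (mem_sdiff.1 hs).2]
  rw [cost_sub_cost_sub, h1, h2, gap]
  ring

end Basics

/-! ### Reduction of optimality to the planar problem. -/

section Optimality

variable {S : Type*} [Fintype S] [DecidableEq S] {P : Problem S} {B : Spec S}

/-- A feasible deviation vector yields feasible parameters; a parameter on which the deviation
vector does not depend can be prescribed. -/
theorem Problem.IsFeasible.exists_feasPair (hB : P.IsSpecLU B) {q : S → ℝ} (hq : P.IsFeasible q)
    {d D : ℝ} (h : InBounds B d D) :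
    ∃ x y, FeasPair P B x y ∧
      ((∃ s ∈ P.Fs, s ∉ B.S₀ ∧ x + y = P.w s * q s) ∨
        ((∀ s ∈ P.Fs, s ∈ B.S₀) ∧ x + y = d + D)) ∧
      ((∃ s, s ∉ P.Fs ∧ s ∉ B.S₀ ∧ y = P.w s * q s) ∨
        ((∀ s, s ∉ P.Fs → s ∈ B.S₀) ∧ y = D)) := by
  have hb := fun s => (bounds_iff hB s (q s)).1 (hq.2 s)
  -- `A` is the maximum of the weighted values on `P.Fs \ B.S₀`. If that set is empty, all `al`
  -- vanish and `d + D` serves.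
  obtain ⟨A, hA, hA1, hA2, hA3⟩ : ∃ A : ℝ, ((∃ s ∈ P.Fs, s ∉ B.S₀ ∧ A = P.w s * q s) ∨
        ((∀ s ∈ P.Fs, s ∈ B.S₀) ∧ A = d + D)) ∧ B.ℓin ≤ (A : EReal) ∧ (A : EReal) ≤ B.uin ∧
        ∀ s ∈ P.Fs, s ∉ B.S₀ → P.w s * q s ≤ A := by
    by_cases hne : (P.Fs \ B.S₀).Nonempty
    · obtain ⟨s, hs, hmax⟩ := exists_max_image _ (fun s => P.w s * q s) hne
      rw [mem_sdiff] at hs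
      have := hb s
      rw [if_neg hs.2, if_pos hs.1, mul_comm] at this
      exact ⟨_, .inl ⟨s, hs.1, hs.2, rfl⟩, this.1, this.2,
        fun t ht ht' => hmax t (mem_sdiff.2 ⟨ht, ht'⟩)⟩
    · rw [not_nonempty_iff_eq_empty, sdiff_eq_empty_iff_subset] at hne
      exact ⟨_, .inr ⟨fun s hs => hne hs, rfl⟩, h.lin, h.uin, fun s hs hs' => (hs' (hne hs)).elim⟩
  obtain ⟨E, hE, hE1, hE2, hE3⟩ : ∃ E : ℝ, ((∃ s, s ∉ P.Fs ∧ s ∉ B.S₀ ∧ E = P.w s * q s) ∨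
        ((∀ s, s ∉ P.Fs → s ∈ B.S₀) ∧ E = D)) ∧ B.ℓout ≤ (E : EReal) ∧ (E : EReal) ≤ B.uout ∧
        ∀ s, s ∉ P.Fs → s ∉ B.S₀ → E ≤ P.w s * q s := by
    by_cases hne : (univ \ (P.Fs ∪ B.S₀)).Nonempty
    · obtain ⟨s, hs, hmin⟩ := exists_min_image _ (fun s => P.w s * q s) hne
      simp only [mem_sdiff, mem_union, not_or, mem_univ, true_and] at hs hmin
      have := hb s
      rw [if_neg hs.2, if_neg hs.1, mul_comm] at this
      exact ⟨_, .inl ⟨s, hs.1, hs.2, rfl⟩, this.1, this.2, fun t ht ht' => hmin t ⟨ht, ht'⟩⟩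
    · rw [not_nonempty_iff_eq_empty, sdiff_eq_empty_iff_subset] at hne
      have hne' : ∀ s, s ∉ P.Fs → s ∈ B.S₀ := fun s hs => by
        have := hne (mem_univ s)
        grind
      exact ⟨_, .inr ⟨hne', rfl⟩, h.lout, h.uout, fun s hs hs' => (hs' (hne' s hs)).elim⟩
  refine ⟨A - E, E, ⟨⟨?_, ?_, hE1, hE2⟩, fun F hF => ?_⟩, ?_, hE⟩
  · rwa [sub_add_cancel]
  · rwa [sub_add_cancel]
  · have h1 : ∑ s ∈ P.Fs \ F, q s ≤ A * al P B F := by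
      rw [al, mu_eq_sum_wt, mul_sum]
      refine sum_le_sum fun s hs => ?_
      rw [mem_sdiff] at hs
      by_cases h0 : s ∈ B.S₀
      · have := hb s
        rw [if_pos h0] at this
        simp [wt, h0, this]
      · have := hA3 s hs.1 h0
        rw [wt, if_neg h0, mul_one_div, le_div_iff₀ (P.w_pos s)]
        linarith
    have h2 : E * be P B F ≤ ∑ s ∈ F \ P.Fs, q s := by
      rw [be, mu_eq_sum_wt, mul_sum]
      refine sum_le_sum fun s hs => ?_
      rw [mem_sdiff] at hs
      by_cases h0 : s ∈ B.S₀
      · have := hb s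
        rw [if_pos h0] at this
        simp [wt, h0, this]
      · have := hE3 s hs.2 h0
        rw [wt, if_neg h0, mul_one_div, div_le_iff₀ (P.w_pos s)]
        linarith
    have h3 := hq.1 F hF
    have h4 := cost_sub_cost_sub P.c q P.Fs F
    rw [gap]
    linarith
  · rwa [sub_add_cancel]

omit [DecidableEq S] in
theorem sub_le_wspan [Nonempty S] (w p : S → ℝ) (s t : S) : w s * p s - w t * p t ≤ wspan w p :=
  sub_le_sub (le_sup' (fun s => w s * p s) (mem_univ s)) (inf'_le (fun s => w s * p s) (mem_univ t))

omit [DecidableEq S] in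
theorem wspan_le [Nonempty S] (w p : S → ℝ) (r : ℝ)
    (h : ∀ s t, w s * p s - w t * p t ≤ r) : wspan w p ≤ r := by
  obtain ⟨s, -, hs⟩ := exists_mem_eq_sup' univ_nonempty (fun s => w s * p s)
  obtain ⟨t, -, ht⟩ := exists_mem_eq_inf' univ_nonempty (fun s => w s * p s)
  rw [wspan, hs, ht]
  exact h s t

omit [Fintype S] in
theorem mul_dev_eq (hB : P.IsSpecLU B) {d D : ℝ} (h : InBounds B d D) (s : S) :
    P.w s * P.dev d D s = if s ∈ B.S₀ then 0 else if s ∈ P.Fs then d + D else D := by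
  have hw := (P.w_pos s).ne'
  rw [dev_eq hB h, wt]
  by_cases h0 : s ∈ B.S₀
  · simp [h0]
  · simp only [h0, if_false]
    field_simp

/-- Feasible parameters with the smallest possible first parameter yield an optimal vector. -/
theorem isOptimal_dev [Nonempty S] (hB : P.IsSpecLU B) {d D : ℝ} (h : FeasPair P B d D)
    (hd : 0 ≤ d) (hmin : ∀ x y, FeasPair P B x y → d ≤ max x 0) : P.IsOptimal (P.dev d D) := by
  have hb := h.toInBounds
  refine ⟨⟨fun F hF => ?_, dev_bounds hB hb⟩, fun q hq => wspan_le _ _ _ fun s t => ?_⟩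
  · have h1 := violation_eq hB hb F
    have h2 := h.le F hF
    linarith
  · obtain ⟨x, y, hxy, hA, hE⟩ := hq.exists_feasPair hB hb
    have hx' := le_max_iff.1 (hmin x y hxy)
    have hz : ∀ r ∈ B.S₀, P.w r * q r = 0 := fun r hr => by
      have := (bounds_iff hB r (q r)).1 (hq.2 r)
      rw [if_pos hr] at this
      simp [this]
    have hspan := sub_le_wspan P.w q
    have hself : 0 ≤ wspan P.w q := by simpa using hspan s s
    have hin : ∀ r ∈ B.S₀, 0 ≤ d + D := fun r hr => by
      exact_mod_cast (hB.ℓin_nonneg ⟨r, hr⟩).trans hb.lin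
    have hout : ∀ r ∈ B.S₀, D ≤ 0 := fun r hr => by
      exact_mod_cast hb.uout.trans (hB.uout_nonpos ⟨r, hr⟩)
    rw [mul_dev_eq hB hb, mul_dev_eq hB hb]
    have hAB : ∀ s t, s ∈ P.Fs → s ∉ B.S₀ → t ∉ P.Fs → t ∉ B.S₀ → d ≤ wspan P.w q := by
      intro s t hs hs' ht ht'
      obtain hx | hx := hx'
      swap
      · linarith
      obtain ⟨s', -, -, h1⟩ | ⟨h1, -⟩ := hA
      · obtain ⟨t', -, -, h2⟩ | ⟨h2, -⟩ := hE
        · linarith [hspan s' t']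
        · exact (ht' (h2 t ht)).elim
      · exact (hs' (h1 s hs)).elim
    -- A free element off `P.Fs` gives `d ≤ wspan P.w q`, and `D ≤ 0` finishes. Without one, `y = D`
    -- was prescribed, so `d ≤ x` yields `d + D ≤ x + y`, a weighted value of `q`, to be compared
    -- with the value `0` at `r`.
    have hA0 : ∀ s r, s ∈ P.Fs → s ∉ B.S₀ → r ∈ B.S₀ → d + D ≤ wspan P.w q := by
      intro s r hs hs' hr
      obtain hx | hx := hx'
      swap
      · linarith [hin r hr, hout r hr]
      obtain ⟨t', h1, h2, -⟩ | ⟨-, h2⟩ := hE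
      · linarith [hAB s t' hs hs' h1 h2, hout r hr]
      · obtain ⟨s', -, -, h1⟩ | ⟨h1, -⟩ := hA
        · linarith [hspan s' r, hz r hr]
        · exact (hs' (h1 s hs)).elim
    have hE0 : ∀ t r, t ∉ P.Fs → t ∉ B.S₀ → r ∈ B.S₀ → -D ≤ wspan P.w q := by
      intro t r ht ht' hr
      obtain hx | hx := hx'
      swap
      · linarith [hin r hr, hout r hr]
      obtain ⟨s', h1, h2, -⟩ | ⟨-, h2⟩ := hA
      · linarith [hAB s' t h1 h2 ht ht', hin r hr]
      · obtain ⟨t', -, -, h1⟩ | ⟨h1, -⟩ := hE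
        · linarith [hspan r t', hz r hr]
        · exact (ht' (h1 t ht)).elim
    split_ifs with h1 h2 h3 h4 h5 h6 h7 h8
    · linarith
    · linarith [hin s h1]
    · linarith [hE0 t s h3 h2 h1]
    · linarith [hA0 s t h4 h1 h5]
    · linarith
    · linarith [hAB s t h4 h1 h6 h5]
    · linarith [hout t h7]
    · linarith
    · linarith

end Optimality

/-! ### Sliding along a violated line to its last admissible bound. -/

section Branches

variable {S : Type*} [DecidableEq S] {P : Problem S} {B : Spec S}

/-- The violation of the constraint of `F` by the current parameters. -/
noncomputable def State.viol (P : Problem S) (σ : State S) (F : Finset S) : ℝ :=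
  cost (σ.cur P) P.Fs - cost (σ.cur P) F

/-- The value of `d` at which the constraint of a set with parameters `α = p`, `β = q` and gap `g`
meets one of the four bound constraints. -/
noncomputable def lineVal (B : Spec S) : Fin 4 → ℝ → ℝ → ℝ → ℝ
  | 0, p, q, g => (g - B.uout.toReal * (p - q)) / p
  | 1, p, q, g => (g - B.uin.toReal * (p - q)) / q
  | 2, p, q, g => (g - B.ℓin.toReal * (p - q)) / q
  | 3, p, q, g => (g - B.ℓout.toReal * (p - q)) / p

/-- The value of `d` at which the constraints of two sets meet. -/
noncomputable def pairVal (p q g p' q' g' : ℝ) : ℝ :=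
  ((q' - p') * g + (p - q) * g') / (p * (q' - p') + p' * (p - q))

/-- The increments `δ`, `Δ` lead to admissible parameters for which the constraint of `F` is tight
and the first parameter is still a lower bound. -/
structure Valid (P : Problem S) (B : Spec S) (d D : ℝ) (F : Finset S) (δ Δ : ℝ) : Prop where
  inb : InBounds B (d + δ) (D + Δ)
  tight : gap P F = (d + δ) * al P B F + (D + Δ) * (al P B F - be P B F)
  lower : ∀ x y, FeasPair P B x y → d + δ ≤ max x 0

/-- The constraint of `F` is met on a bound constraint, and `d` increases. -/
structure Hit (P : Problem S) (B : Spec S) (d D : ℝ) (F : Finset S) (δ Δ : ℝ) : Prop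
    extends Valid P B d D F δ Δ where
  pos : 0 < δ
  key : ∃ i, d + δ = lineVal B i (al P B F) (be P B F) (gap P F)

/-- The current parameters are admissible and violate the constraint of the oracle's answer. -/
structure Violated (P : Problem S) (B : Spec S) (σ : State S) : Prop where
  inb : InBounds B σ.d σ.D
  mem : σ.F ∈ P.𝓕
  pos : 0 < σ.viol P σ.F
  eq : σ.viol P σ.F = gap P σ.F - σ.d * al P B σ.F - σ.D * (al P B σ.F - be P B σ.F)

/-- Either a branch certifies infeasibility, or it updates the state such that `R` holds. -/
def BranchOK (P : Problem S) (B : Spec S) (r : Option (Update S)) (R : Update S → Prop) : Prop :=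
  (r = none ∧ ∀ x y, ¬ FeasPair P B x y) ∨ ∃ U, r = some U ∧ R U

theorem exists_of_not_coe_le {x : EReal} (hx : x ≠ ⊥) {t : ℝ} (h : ¬ (t : EReal) ≤ x) :
    ∃ r : ℝ, x = r ∧ r < t := by
  rw [not_le] at h
  lift x to ℝ using ⟨h.ne_top, hx⟩
  exact ⟨x, rfl, by exact_mod_cast h⟩

theorem exists_of_not_le_coe {x : EReal} (hx : x ≠ ⊤) {t : ℝ} (h : ¬ x ≤ (t : EReal)) :
    ∃ r : ℝ, x = r ∧ t < r := by
  rw [not_le] at h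
  lift x to ℝ using ⟨hx, h.ne_bot⟩
  exact ⟨x, rfl, by exact_mod_cast h⟩

/-- The point reached by `δ₀`, `Δ₀` lies on the line of `σ.F` but beyond `x + y = u`. Sliding along
the line to `x + y = u` lowers `y` and raises `x` above `σ.d + δ₀`; only the bound `ℓout` can then
fail, and its failure excludes all feasible pairs. -/
theorem raise_ok (hB : P.IsSpecLU B) {σ : State S} (V : Violated P B σ) {u : ℝ} (hu : B.uin = u)
    (ha : 0 < al P B σ.F - be P B σ.F) {δ₀ Δ₀ : ℝ} (h0 : 0 ≤ δ₀)
    (hl : δ₀ * al P B σ.F + Δ₀ * (al P B σ.F - be P B σ.F) = σ.viol P σ.F)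
    (huo : ((σ.D + Δ₀ : ℝ) : EReal) ≤ B.uout) (hgt : u < σ.d + σ.D + δ₀ + Δ₀)
    (X Y Z : Option (Finset S)) :
    BranchOK P B (raise P B σ X Y Z) fun U =>
      U.X = X ∧ U.Z = Z ∧ Hit P B σ.d σ.D σ.F U.δ U.Δ := by
  have hal := al_nonneg (P := P) (B := B) σ.F
  have hbe := be_nonneg (P := P) (B := B) σ.F
  have e4 : f4 P B (σ.cur P) σ.d σ.D σ.F =
      (-σ.viol P σ.F + (u - σ.d - σ.D) * al P B σ.F) / be P B σ.F := by
    simp only [f4, hu, EReal.toReal_coe, State.viol, al, be, neg_sub]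
  have e5 : f5 P B (σ.cur P) σ.d σ.D σ.F =
      (σ.viol P σ.F - (u - σ.d - σ.D) * (al P B σ.F - be P B σ.F)) / be P B σ.F := by
    simp only [f5, hu, EReal.toReal_coe, State.viol, be, mu_sub_mu, al]
  have hv := V.eq
  simp only [raise, ← be_pos_iff, e4, e5]
  generalize σ.viol P σ.F = γ at *
  generalize hp : al P B σ.F = p at *
  generalize hq : be P B σ.F = q at *
  have huu : ∀ x y, FeasPair P B x y → x + y ≤ u := fun x y h => by
    have := h.uin
    rw [hu] at this
    exact_mod_cast this
  have hF : ∀ x y, FeasPair P B x y → gap P σ.F ≤ x * p + y * (p - q) := fun x y h => by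
    have := h.le _ V.mem
    rwa [hp, hq] at this
  have hp0 : 0 < p := by linarith
  split_ifs with h
  · right
    refine ⟨_, rfl, rfl, rfl, ⟨⟨?_, ?_, ?_⟩, ?_, 1, ?_⟩⟩ <;> dsimp only
    · have hsum : σ.d + (γ - (u - σ.d - σ.D) * (p - q)) / q +
          (σ.D + (-γ + (u - σ.d - σ.D) * p) / q) = u := by
        have := h.1.ne'
        field_simp
        ring
      refine ⟨?_, ?_, h.2, le_trans ?_ huo⟩
      · rw [hsum, ← hu]
        exact hB.in_le
      · rw [hsum, hu]
      · rw [EReal.coe_le_coe_iff, add_le_add_iff_left, div_le_iff₀ h.1]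
        nlinarith [mul_pos hp0 (sub_pos.2 hgt)]
    · have := h.1.ne'
      rw [hp, hq]
      field_simp
      linear_combination (-q) * hv
    · intro x y hxy
      have h1 := huu x y hxy
      have h2 := hF x y hxy
      refine le_max_of_le_left ?_
      -- The right side of the constraint is `x * q + (x + y) * (p - q)`, where `x + y ≤ u` and `p -
      -- q > 0`.
      rw [← le_sub_iff_add_le', div_le_iff₀ h.1]
      nlinarith [mul_le_mul_of_nonneg_right h1 ha.le]
    · refine div_pos ?_ h.1
      nlinarith [mul_pos ha (sub_pos.2 hgt), mul_nonneg h0 h.1.le]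
    · have := h.1.ne'
      simp only [lineVal, hu, EReal.toReal_coe, hp, hq]
      field_simp
      linear_combination hv
  · left
    refine ⟨rfl, fun x y hxy => h ?_⟩
    have h1 := huu x y hxy
    have h2 := hF x y hxy
    -- For `q = 0` the constraint says that `x + y` is at least `σ.d + σ.D + δ₀ + Δ₀`, which exceeds
    -- `u`.
    have hq0 : 0 < q := by
      rcases hbe.lt_or_eq with h | h
      · exact h
      · rw [← h] at h2 hv hl
        nlinarith [mul_le_mul_of_nonneg_right h1 hal, mul_pos hp0 (sub_pos.2 hgt)]
    refine ⟨hq0, hxy.lout.trans ?_⟩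
    rw [EReal.coe_le_coe_iff, ← sub_le_iff_le_add', le_div_iff₀ hq0]
    nlinarith [mul_le_mul_of_nonneg_right h1 hal]

/-- Mirror image of `raise_ok`: the point on the line of `σ.F` lies below `y = l`. Sliding up to `y
= l` raises `x` and `x + y`, so only `uin` can fail. -/
theorem lower_ok (hB : P.IsSpecLU B) {σ : State S} (V : Violated P B σ) {l : ℝ} (hlo : B.ℓout = l)
    (ha : al P B σ.F - be P B σ.F < 0) {δ₀ Δ₀ : ℝ} (h0 : 0 ≤ δ₀)
    (hl : δ₀ * al P B σ.F + Δ₀ * (al P B σ.F - be P B σ.F) = σ.viol P σ.F)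
    (hli : B.ℓin ≤ ((σ.d + σ.D + δ₀ + Δ₀ : ℝ) : EReal)) (hgt : σ.D + Δ₀ < l)
    (X Y Z : Option (Finset S)) :
    BranchOK P B (lower P B σ X Y Z) fun U =>
      U.X = X ∧ U.Z = Z ∧ Hit P B σ.d σ.D σ.F U.δ U.Δ := by
  have hal := al_nonneg (P := P) (B := B) σ.F
  have hbe := be_nonneg (P := P) (B := B) σ.F
  have e9 : f9 P B (σ.cur P) σ.D σ.F =
      (σ.viol P σ.F - (l - σ.D) * (al P B σ.F - be P B σ.F)) / al P B σ.F := by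
    simp only [f9, hlo, EReal.toReal_coe, State.viol, be, mu_sub_mu, al]
  have hiff : ∀ t : ℝ, (t : EReal) ≤ B.uin - B.ℓout ↔ ((t + l : ℝ) : EReal) ≤ B.uin := by
    intro t
    rw [hlo, EReal.coe_add]
    exact EReal.le_sub_iff_add_le (.inl (EReal.coe_ne_bot _)) (.inl (EReal.coe_ne_top _))
  have hv := V.eq
  have hlo' : B.ℓout.toReal = l := by rw [hlo, EReal.toReal_coe]
  simp only [lower, ← al_pos_iff, e9, hiff, hlo']
  generalize σ.viol P σ.F = γ at *
  generalize hp : al P B σ.F = p at *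
  generalize hq : be P B σ.F = q at *
  have hly : ∀ x y, FeasPair P B x y → l ≤ y := fun x y h => by
    have := h.lout
    rw [hlo] at this
    exact_mod_cast this
  have hF : ∀ x y, FeasPair P B x y → gap P σ.F ≤ x * p + y * (p - q) := fun x y h => by
    have := h.le _ V.mem
    rwa [hp, hq] at this
  have hq0 : 0 < q := by linarith
  split_ifs with h
  · right
    have hp0 := h.1.ne'
    refine ⟨_, rfl, rfl, rfl, ⟨⟨?_, ?_, ?_⟩, ?_, 3, ?_⟩⟩ <;> dsimp only
    · rw [add_sub_cancel]
      refine ⟨hli.trans ?_, h.2, hlo.le, ?_⟩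
      · rw [EReal.coe_le_coe_iff, ← sub_nonneg]
        have : 0 ≤ (γ - (l - σ.D) * (p - q)) / p - (δ₀ + Δ₀ + σ.D - l) := by
          rw [sub_nonneg, le_div_iff₀ h.1]
          nlinarith [mul_pos hq0 (sub_pos.2 hgt)]
        linarith
      · rw [← hlo]
        exact hB.out_le
    · rw [hp, hq]
      field_simp
      linear_combination (-1) * hv
    · intro x y hxy
      have h1 := hly x y hxy
      have h2 := hF x y hxy
      refine le_max_of_le_left ?_
      rw [← le_sub_iff_add_le', div_le_iff₀ h.1]
      nlinarith [mul_le_mul_of_nonpos_right h1 ha.le]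
    · refine div_pos ?_ h.1
      nlinarith [mul_pos_of_neg_of_neg ha (sub_neg.2 hgt), mul_nonneg h0 h.1.le]
    · simp only [lineVal, hlo, EReal.toReal_coe, hp, hq]
      field_simp
      linear_combination hv
  · left
    refine ⟨rfl, fun x y hxy => h ?_⟩
    have h1 := hly x y hxy
    have h2 := hF x y hxy
    -- For `p = 0` the constraint caps `y` by `σ.D + Δ₀`, which is below `l`.
    have hp0 : 0 < p := by
      rcases hal.lt_or_eq with h | h
      · exact h
      · rw [← h] at h2 hv hl
        nlinarith [mul_le_mul_of_nonneg_right h1 hbe, mul_pos hq0 (sub_pos.2 hgt)]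
    refine ⟨hp0, le_trans ?_ hxy.uin⟩
    rw [EReal.coe_le_coe_iff]
    have : (γ - (l - σ.D) * (p - q)) / p ≤ x + y - l - σ.d := by
      rw [div_le_iff₀ hp0]
      nlinarith [mul_le_mul_of_nonneg_right h1 hbe]
    linarith

end Branches

/-! ### The case distinction by the sign of `al - be`. -/

section Branches

variable {S : Type*} [DecidableEq S] {P : Problem S} {B : Spec S}

theorem BranchOK.mono {r : Option (Update S)} {R R' : Update S → Prop} (h : BranchOK P B r R)
    (hR : ∀ U, R U → R' U) : BranchOK P B r R' := by
  obtain h | ⟨U, h, hU⟩ := h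
  · exact .inl h
  · exact .inr ⟨U, h, hR U hU⟩

theorem Violated.tight {σ : State S} (V : Violated P B σ) {δ Δ : ℝ}
    (hl : δ * al P B σ.F + Δ * (al P B σ.F - be P B σ.F) = σ.viol P σ.F) :
    gap P σ.F = (σ.d + δ) * al P B σ.F + (σ.D + Δ) * (al P B σ.F - be P B σ.F) := by
  linear_combination (-1) * hl - V.eq

/-- The line of `σ.F` is vertical, so its constraint bounds `x` alone; `lineVal B 0` records this
value since its `uout` term vanishes. If `D` cannot stay, descending to `x + y = uin` is the least
change. -/
theorem case1_ok (hB : P.IsSpecLU B) {σ : State S} (V : Violated P B σ)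
    (ha : al P B σ.F - be P B σ.F = 0) :
    BranchOK P B (case1 P B σ) fun U =>
      U.X = none ∧ U.Z = none ∧ Hit P B σ.d σ.D σ.F U.δ U.Δ := by
  have hal := al_nonneg (P := P) (B := B) σ.F
  have e1 : f1 P B (σ.cur P) σ.F = σ.viol P σ.F / al P B σ.F := rfl
  have e2 : f2 P B (σ.cur P) σ.d σ.D σ.F =
      B.uin.toReal - σ.d - σ.D - σ.viol P σ.F / al P B σ.F := rfl
  rw [case1, e1, e2]
  have hpos := V.pos
  by_cases h0 : al P B σ.F = 0
  -- Here `al` and `be` both vanish, so the constraint does not involve the parameters and no pair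
  -- can repair its violation.
  · have h1 : P.Fs \ B.S₀ ⊆ σ.F \ B.S₀ := not_not.1 fun h => ((al_pos_iff σ.F).2 h).ne' h0
    have h2 : σ.F \ B.S₀ ⊆ P.Fs \ B.S₀ := not_not.1 fun h => by
      linarith [(be_pos_iff σ.F).2 h]
    rw [if_pos (h2.antisymm h1)]
    refine .inl ⟨rfl, fun x y h => ?_⟩
    have h3 := h.le _ V.mem
    have h4 := V.eq
    rw [ha, h0] at h3 h4
    linarith
  · have hp : 0 < al P B σ.F := lt_of_le_of_ne hal (Ne.symm h0)
    rw [if_neg fun h => (al_pos_iff σ.F).1 hp h.ge]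
    have hδ := div_pos hpos hp
    have hlow : ∀ x y, FeasPair P B x y → σ.d + σ.viol P σ.F / al P B σ.F ≤ x := by
      intro x y h
      have h3 := h.le _ V.mem
      rw [← le_sub_iff_add_le', div_le_iff₀ hp, V.eq]
      rw [ha] at h3 ⊢
      linarith
    have hkey : σ.d + σ.viol P σ.F / al P B σ.F =
        lineVal B 0 (al P B σ.F) (be P B σ.F) (gap P σ.F) := by
      simp only [lineVal, V.eq, ha]
      field_simp
      ring
    have hline : ∀ Δ : ℝ, σ.viol P σ.F / al P B σ.F * al P B σ.F +
        Δ * (al P B σ.F - be P B σ.F) = σ.viol P σ.F := by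
      intro Δ
      rw [ha, div_mul_cancel₀ _ h0]
      ring
    split_ifs with h1 h2
    · refine .inr ⟨_, rfl, rfl, rfl, ⟨⟨⟨V.inb.lin.trans ?_, ?_, ?_, ?_⟩, V.tight (hline 0),
        fun x y h => le_max_of_le_left (hlow x y h)⟩,
        hδ, 0, hkey⟩⟩
      · rw [EReal.coe_le_coe_iff]
        dsimp only
        linarith
      · convert h1 using 2
        dsimp only
        ring
      · simpa using V.inb.lout
      · simpa using V.inb.uout
    · obtain ⟨u, hu, hlt⟩ := exists_of_not_coe_le (fun h => by
        simpa [h] using V.inb.uin) h1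
      rw [hu, EReal.toReal_coe] at h2 ⊢
      have hsum : σ.d + σ.viol P σ.F / al P B σ.F +
          (σ.D + (u - σ.d - σ.D - σ.viol P σ.F / al P B σ.F)) = u := by ring
      refine .inr ⟨_, rfl, rfl, rfl, ⟨⟨⟨?_, ?_, h2, le_trans ?_ V.inb.uout⟩,
        V.tight (hline _), fun x y h => le_max_of_le_left (hlow x y h)⟩, hδ, 0, hkey⟩⟩
      · dsimp only
        rw [hsum, ← hu]
        exact hB.in_le
      · dsimp only
        rw [hsum, hu]
      · rw [EReal.coe_le_coe_iff]
        dsimp only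
        linarith
    · obtain ⟨u, hu, hlt⟩ := exists_of_not_coe_le (fun h => by
        simpa [h] using V.inb.uin) h1
      rw [hu, EReal.toReal_coe] at h2
      refine .inl ⟨rfl, fun x y h => h2 (h.lout.trans ?_)⟩
      have h3 := h.uin
      have h4 := hlow x y h
      rw [hu, EReal.coe_le_coe_iff] at h3
      rw [EReal.coe_le_coe_iff]
      linarith

/-- The common part of Cases 2 and 3. -/
noncomputable def upBranch (P : Problem S) (B : Spec S) (σ : State S) (δ Δ : ℝ)
    (Z Z' : Option (Finset S)) : Option (Update S) :=
  if ((σ.D + Δ : ℝ) : EReal) ≤ B.uout then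
    if ((σ.d + σ.D + δ + Δ : ℝ) : EReal) ≤ B.uin then some ⟨some σ.F, σ.Y, Z, δ, Δ⟩
    else raise P B σ (some σ.F) σ.Y Z'
  else if ((σ.d + f6 P B (σ.cur P) σ.D σ.F : ℝ) : EReal) ≤ B.uin - B.uout then
    some ⟨some σ.F, σ.Y, Z', f6 P B (σ.cur P) σ.D σ.F, B.uout.toReal - σ.D⟩
  else raise P B σ (some σ.F) σ.Y Z'

/-- Nonnegative increments protect the lower bounds, so only `uout` and `uin` can fail. They are
repaired in this order by sliding along the line of `σ.F`, each slide increasing `x`. `Z` is the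
record kept when the proposed point is accepted, `Z'` the one kept after a slide. -/
theorem upBranch_ok (hB : P.IsSpecLU B) {σ : State S} (V : Violated P B σ)
    (ha : 0 < al P B σ.F - be P B σ.F) {δ Δ : ℝ} (h0 : 0 ≤ δ) (h0' : 0 ≤ Δ)
    (hl : δ * al P B σ.F + Δ * (al P B σ.F - be P B σ.F) = σ.viol P σ.F)
    (hlow : ∀ x y, FeasPair P B x y → σ.d + δ ≤ max x 0) (Z Z' : Option (Finset S)) :
    BranchOK P B (upBranch P B σ δ Δ Z Z') fun U => U.X = some σ.F ∧
      ((U.Z = Z ∧ U.δ = δ ∧ U.Δ = Δ ∧ Valid P B σ.d σ.D σ.F U.δ U.Δ) ∨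
        (U.Z = Z' ∧ Hit P B σ.d σ.D σ.F U.δ U.Δ)) := by
  have hbe := be_nonneg (P := P) (B := B) σ.F
  have hp : 0 < al P B σ.F := by linarith
  rw [upBranch]
  by_cases h1 : ((σ.D + Δ : ℝ) : EReal) ≤ B.uout
  · rw [if_pos h1]
    split_ifs with h2
    · refine .inr ⟨_, rfl, rfl, .inl ⟨rfl, rfl, rfl, ⟨⟨V.inb.lin.trans ?_, ?_, V.inb.lout.trans ?_,
        h1⟩, V.tight hl, hlow⟩⟩⟩
      · rw [EReal.coe_le_coe_iff]
        dsimp only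
        linarith
      · convert h2 using 2
        dsimp only
        ring
      · rw [EReal.coe_le_coe_iff]
        dsimp only
        linarith
    · obtain ⟨u, hu, hlt⟩ := exists_of_not_coe_le hB.uin_ne_bot h2
      exact (raise_ok hB V hu ha h0 hl h1 hlt _ _ _).mono fun U hU => ⟨hU.1, .inr hU.2⟩
  · rw [if_neg h1]
    obtain ⟨r, hr, hlt⟩ := exists_of_not_coe_le hB.uout_ne_bot h1
    have e6 : f6 P B (σ.cur P) σ.D σ.F =
        (σ.viol P σ.F - (r - σ.D) * (al P B σ.F - be P B σ.F)) / al P B σ.F := by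
      simp only [f6, hr, EReal.toReal_coe, State.viol, be, mu_sub_mu, al]
    have hiff : ∀ t : ℝ, (t : EReal) ≤ B.uin - B.uout ↔ ((t + r : ℝ) : EReal) ≤ B.uin := by
      intro t
      rw [hr, EReal.coe_add]
      exact EReal.le_sub_iff_add_le (.inl (EReal.coe_ne_bot _)) (.inl (EReal.coe_ne_top _))
    have hr' : B.uout.toReal = r := by rw [hr, EReal.toReal_coe]
    have hDr : σ.D ≤ r := by
      have := V.inb.uout
      rw [hr] at this
      exact_mod_cast this
    simp only [e6, hiff, hr']
    have hl' : (σ.viol P σ.F - (r - σ.D) * (al P B σ.F - be P B σ.F)) / al P B σ.F * al P B σ.F +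
        (r - σ.D) * (al P B σ.F - be P B σ.F) = σ.viol P σ.F := by
      rw [div_mul_cancel₀ _ hp.ne', sub_add_cancel]
    have hpos : 0 < (σ.viol P σ.F - (r - σ.D) * (al P B σ.F - be P B σ.F)) / al P B σ.F := by
      refine div_pos ?_ hp
      nlinarith [mul_pos ha (sub_pos.2 hlt), mul_nonneg h0 hp.le]
    have hlow' : ∀ x y, FeasPair P B x y →
        σ.d + (σ.viol P σ.F - (r - σ.D) * (al P B σ.F - be P B σ.F)) / al P B σ.F ≤ max x 0 := by
      intro x y h
      refine le_max_of_le_left ?_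
      have h2 := h.le _ V.mem
      have h3 := h.uout
      rw [hr, EReal.coe_le_coe_iff] at h3
      rw [← le_sub_iff_add_le', div_le_iff₀ hp, V.eq]
      nlinarith [mul_le_mul_of_nonneg_right h3 ha.le]
    have hkey : σ.d + (σ.viol P σ.F - (r - σ.D) * (al P B σ.F - be P B σ.F)) / al P B σ.F =
        lineVal B 0 (al P B σ.F) (be P B σ.F) (gap P σ.F) := by
      have := hp.ne'
      simp only [lineVal, V.eq, hr']
      field_simp
      ring
    split_ifs with h2
    · refine .inr ⟨_, rfl, rfl, .inr ⟨rfl, ⟨⟨⟨V.inb.lin.trans ?_, ?_, ?_, ?_⟩, V.tight hl', hlow'⟩,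
        hpos, 0, hkey⟩⟩⟩
      · rw [EReal.coe_le_coe_iff]
        dsimp only
        linarith
      · dsimp only
        rwa [add_sub_cancel]
      · dsimp only
        rw [add_sub_cancel, ← hr]
        exact hB.out_le
      · dsimp only
        rw [add_sub_cancel, ← hr]
    · obtain ⟨u, hu, hlt'⟩ := exists_of_not_coe_le hB.uin_ne_bot h2
      refine (raise_ok hB V hu ha hpos.le hl' ?_ ?_ _ _ _).mono fun U hU => ⟨hU.1, .inr hU.2⟩
      · rw [add_sub_cancel, ← hr]
      · linarith

/-- The common part of Cases 4 and 5. -/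
noncomputable def downBranch (P : Problem S) (B : Spec S) (σ : State S) (δ Δ : ℝ)
    (X X' : Option (Finset S)) : Option (Update S) :=
  if B.ℓin ≤ ((σ.d + σ.D + δ + Δ : ℝ) : EReal) then
    if B.ℓout ≤ ((σ.D + Δ : ℝ) : EReal) then some ⟨X, σ.Y, some σ.F, δ, Δ⟩
    else lower P B σ X' σ.Y (some σ.F)
  else if B.ℓout ≤ ((σ.D + f10 P B (σ.cur P) σ.d σ.D σ.F : ℝ) : EReal) then
    some ⟨X', σ.Y, some σ.F, f11 P B (σ.cur P) σ.d σ.D σ.F, f10 P B (σ.cur P) σ.d σ.D σ.F⟩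
  else lower P B σ X' σ.Y (some σ.F)

/-- The signs of `Δ` and `δ + Δ` protect the upper bounds, so the repairs concern `ℓin` and then
`ℓout`. -/
theorem downBranch_ok (hB : P.IsSpecLU B) {σ : State S} (V : Violated P B σ)
    (ha : al P B σ.F - be P B σ.F < 0) {δ Δ : ℝ} (h0 : 0 ≤ δ) (h0' : Δ ≤ 0) (h0'' : δ + Δ ≤ 0)
    (hl : δ * al P B σ.F + Δ * (al P B σ.F - be P B σ.F) = σ.viol P σ.F)
    (hlow : ∀ x y, FeasPair P B x y → σ.d + δ ≤ max x 0) (X X' : Option (Finset S)) :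
    BranchOK P B (downBranch P B σ δ Δ X X') fun U => U.Z = some σ.F ∧
      ((U.X = X ∧ U.δ = δ ∧ U.Δ = Δ ∧ Valid P B σ.d σ.D σ.F U.δ U.Δ) ∨
        (U.X = X' ∧ Hit P B σ.d σ.D σ.F U.δ U.Δ)) := by
  have hal := al_nonneg (P := P) (B := B) σ.F
  have hq : 0 < be P B σ.F := by linarith
  rw [downBranch]
  by_cases h1 : B.ℓin ≤ ((σ.d + σ.D + δ + Δ : ℝ) : EReal)
  · rw [if_pos h1]
    split_ifs with h2
    · refine .inr ⟨_, rfl, rfl, .inl ⟨rfl, rfl, rfl, ⟨⟨?_, le_trans ?_ V.inb.uin, h2,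
        le_trans ?_ V.inb.uout⟩, V.tight hl, hlow⟩⟩⟩
      · convert h1 using 2
        dsimp only
        ring
      · rw [EReal.coe_le_coe_iff]
        dsimp only
        linarith
      · rw [EReal.coe_le_coe_iff]
        dsimp only
        linarith
    · obtain ⟨l, hlo, hlt⟩ := exists_of_not_le_coe hB.ℓout_ne_top h2
      exact (lower_ok hB V hlo ha h0 hl h1 hlt _ _ _).mono fun U hU => ⟨hU.2.1, .inr ⟨hU.1, hU.2.2⟩⟩
  · rw [if_neg h1]
    obtain ⟨r, hr, hlt⟩ := exists_of_not_le_coe hB.ℓin_ne_top h1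
    have e10 : f10 P B (σ.cur P) σ.d σ.D σ.F =
        (-σ.viol P σ.F + (r - σ.d - σ.D) * al P B σ.F) / be P B σ.F := by
      simp only [f10, hr, EReal.toReal_coe, State.viol, al, be, neg_sub]
    have e11 : f11 P B (σ.cur P) σ.d σ.D σ.F =
        (σ.viol P σ.F - (r - σ.d - σ.D) * (al P B σ.F - be P B σ.F)) / be P B σ.F := by
      simp only [f11, hr, EReal.toReal_coe, State.viol, be, mu_sub_mu, al]
    have hr' : B.ℓin.toReal = r := by rw [hr, EReal.toReal_coe]
    have hAr : r ≤ σ.d + σ.D := by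
      have := V.inb.lin
      rw [hr] at this
      exact_mod_cast this
    have hvpos := V.pos
    have hsum : (σ.viol P σ.F - (r - σ.d - σ.D) * (al P B σ.F - be P B σ.F)) / be P B σ.F +
        (-σ.viol P σ.F + (r - σ.d - σ.D) * al P B σ.F) / be P B σ.F = r - σ.d - σ.D := by
      have := hq.ne'
      field_simp
      ring
    have hl' : (σ.viol P σ.F - (r - σ.d - σ.D) * (al P B σ.F - be P B σ.F)) / be P B σ.F *
        al P B σ.F + (-σ.viol P σ.F + (r - σ.d - σ.D) * al P B σ.F) / be P B σ.F *
          (al P B σ.F - be P B σ.F) = σ.viol P σ.F := by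
      have := hq.ne'
      field_simp
      ring
    have hpos : 0 < (σ.viol P σ.F - (r - σ.d - σ.D) * (al P B σ.F - be P B σ.F)) /
        be P B σ.F := by
      refine div_pos ?_ hq
      nlinarith [mul_pos_of_neg_of_neg ha (sub_neg.2 hlt), mul_nonneg h0 hq.le]
    have hneg : (-σ.viol P σ.F + (r - σ.d - σ.D) * al P B σ.F) / be P B σ.F ≤ 0 := by
      refine div_nonpos_of_nonpos_of_nonneg ?_ hq.le
      nlinarith [mul_nonneg hal (sub_nonneg.2 hAr)]
    have hlow' : ∀ x y, FeasPair P B x y → σ.d +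
        (σ.viol P σ.F - (r - σ.d - σ.D) * (al P B σ.F - be P B σ.F)) / be P B σ.F ≤ max x 0 := by
      intro x y h
      refine le_max_of_le_left ?_
      have h2 := h.le _ V.mem
      have h3 := h.lin
      rw [hr, EReal.coe_le_coe_iff] at h3
      rw [← le_sub_iff_add_le', div_le_iff₀ hq, V.eq]
      nlinarith [mul_le_mul_of_nonpos_right h3 ha.le]
    have hkey : σ.d + (σ.viol P σ.F - (r - σ.d - σ.D) * (al P B σ.F - be P B σ.F)) / be P B σ.F =
        lineVal B 2 (al P B σ.F) (be P B σ.F) (gap P σ.F) := by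
      have := hq.ne'
      simp only [lineVal, V.eq, hr']
      field_simp
      ring
    rw [e10, e11]
    split_ifs with h2
    · refine .inr ⟨_, rfl, rfl, .inr ⟨rfl, ⟨⟨⟨?_, ?_, h2, le_trans ?_ V.inb.uout⟩, V.tight hl',
        hlow'⟩, hpos, 2, hkey⟩⟩⟩
      · rw [hr, EReal.coe_le_coe_iff]
        dsimp only
        linarith
      · refine le_trans ?_ hB.in_le
        rw [hr, EReal.coe_le_coe_iff]
        dsimp only
        linarith
      · rw [EReal.coe_le_coe_iff]
        dsimp only
        linarith
    · obtain ⟨l, hlo, hlt'⟩ := exists_of_not_le_coe hB.ℓout_ne_top h2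
      refine (lower_ok hB V hlo ha hpos.le hl' ?_ hlt' _ _ _).mono
        fun U hU => ⟨hU.2.1, .inr ⟨hU.1, hU.2.2⟩⟩
      rw [hr, EReal.coe_le_coe_iff]
      linarith

end Branches

/-! ### The effect of one iteration. -/

section Iteration

variable {S : Type*} [DecidableEq S] {P : Problem S} {B : Spec S}

/-- The intersection of the lines of two sets with `α(X) - β(X) = a > 0 > α(Z) - β(Z) = b`. -/
theorem meet_eq {p a g p' b g' δ : ℝ} (ha : 0 < a) (hb : b < 0)
    (hφ : 0 < p * -b + p' * a) (hδ : δ = (g / a - g' / b) / (p / a - p' / b)) :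
    δ * (p * -b + p' * a) = -b * g + a * g' ∧
      (g - δ * p) / a * a = g - δ * p ∧ δ * p' + (g - δ * p) / a * b = g' ∧
      (g' - δ * p') / b = (g - δ * p) / a := by
  have ha' := ha.ne'
  have hb' := hb.ne
  have hab : p / a - p' / b = (p * -b + p' * a) / (a * -b) := by
    field_simp
    ring
  have h1 : δ * (p * -b + p' * a) = -b * g + a * g' := by
    have hφ' := hφ.ne'
    rw [hδ, hab, div_div_eq_mul_div, div_mul_cancel₀ _ hφ']
    field_simp
    ring
  refine ⟨h1, div_mul_cancel₀ _ ha', ?_, ?_⟩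
  · field_simp
    linear_combination h1
  · field_simp
    linear_combination (-1) * h1

/-- The recorded set `o`, if there is one, has a tight constraint of the given direction. -/
def Recorded (P : Problem S) (B : Spec S) (d D ε : ℝ) (o : Option (Finset S)) : Prop :=
  ∀ X ∈ o, IsClassMax P B X ∧ 0 < ε * (al P B X - be P B X) ∧
    gap P X = d * al P B X + D * (al P B X - be P B X)

theorem recorded_none (d D ε : ℝ) : Recorded P B d D ε none := fun _ h => by simp at h

/-- The first parameter increases to the largest value attained within a class. -/
def Progress (P : Problem S) (B : Spec S) (d' : ℝ) : Prop :=
  (∃ F i, IsClassMax P B F ∧ d' = lineVal B i (al P B F) (be P B F) (gap P F)) ∨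
  ∃ X Z, IsClassMax P B X ∧ IsClassMax P B Z ∧ 0 < al P B X - be P B X ∧
    al P B Z - be P B Z < 0 ∧
    d' = pairVal (al P B X) (be P B X) (gap P X) (al P B Z) (be P B Z) (gap P Z)

/-- What one iteration achieves. -/
structure StepOK (P : Problem S) (B : Spec S) (σ : State S) (U : Update S) : Prop where
  valid : Valid P B σ.d σ.D σ.F U.δ U.Δ
  recX : Recorded P B (σ.d + U.δ) (σ.D + U.Δ) 1 U.X
  recZ : Recorded P B (σ.d + U.δ) (σ.D + U.Δ) (-1) U.Z
  progress : (0 < U.δ ∧ Progress P B (σ.d + U.δ)) ∨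
    (U.δ = 0 ∧ 0 < U.Δ ∧ 0 < al P B σ.F - be P B σ.F ∧ U.X = some σ.F ∧ σ.Z = none) ∨
    (U.δ = 0 ∧ U.Δ < 0 ∧ al P B σ.F - be P B σ.F < 0 ∧ U.Z = some σ.F ∧ U.X = none ∧ σ.X = none)

/-- Without a recorded set of opposite sign the proposed move is vertical. Otherwise it follows the
line of the recorded set, which therefore stays tight, until it meets the line of `σ.F`, and `d`
strictly grows. A slide to a bound leaves the recorded line, so the record is dropped. -/
theorem body_ok (hB : P.IsSpecLU B) {σ : State S} (V : Violated P B σ)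
    (hF : IsClassMax P B σ.F) (hlow : ∀ x y, FeasPair P B x y → σ.d ≤ max x 0)
    (hX : Recorded P B σ.d σ.D 1 σ.X) (hZ : Recorded P B σ.d σ.D (-1) σ.Z)
    (htight : ∀ G, gap P G = σ.d * al P B G + σ.D * (al P B G - be P B G) → σ.viol P G = 0) :
    BranchOK P B (body P B σ) (StepOK P B σ) := by
  have hmu : mu P B P.Fs - mu P B σ.F = al P B σ.F - be P B σ.F := mu_sub_mu σ.F
  have hpos := V.pos
  have hal := al_nonneg (P := P) (B := B) σ.F
  have hbe := be_nonneg (P := P) (B := B) σ.F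
  have e3 : f3 P B (σ.cur P) σ.F = σ.viol P σ.F / (al P B σ.F - be P B σ.F) := by
    simp only [f3, State.viol, mu_sub_mu]
  have recF : ∀ {δ Δ ε : ℝ}, Valid P B σ.d σ.D σ.F δ Δ →
      0 < ε * (al P B σ.F - be P B σ.F) →
      Recorded P B (σ.d + δ) (σ.D + Δ) ε (some σ.F) := by
    intro δ Δ ε hv hs X hX
    obtain rfl : σ.F = X := by simpa using hX
    exact ⟨hF, hs, hv.tight⟩
  have hitP : ∀ {δ Δ : ℝ}, Hit P B σ.d σ.D σ.F δ Δ → Progress P B (σ.d + δ) :=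
    fun h => .inl ⟨σ.F, h.key.choose, hF, h.key.choose_spec⟩
  rw [body]
  split_ifs with h1 h2
  · refine (case1_ok hB V (by linarith)).mono fun U hU => ?_
    obtain ⟨hUX, hUZ, hh⟩ := hU
    exact ⟨hh.toValid, hUX ▸ recorded_none _ _ _, hUZ ▸ recorded_none _ _ _, .inl ⟨hh.pos, hitP hh⟩⟩
  · have ha : 0 < al P B σ.F - be P B σ.F := by linarith
    rcases hZo : σ.Z with _ | Z
    · have e : case2 P B σ = upBranch P B σ 0 (f3 P B (σ.cur P) σ.F) σ.Z σ.Z := by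
        simp only [case2, upBranch, add_zero]
      have hd := div_pos hpos ha
      simp only [e, e3, hZo]
      refine (upBranch_ok hB V ha le_rfl hd.le (by
        rw [zero_mul, zero_add, div_mul_cancel₀ _ ha.ne']) (by simpa using hlow) _ _).mono
        fun U hU => ?_
      obtain ⟨hUX, ⟨hUZ, hδ, hΔ, hv⟩ | ⟨hUZ, hh⟩⟩ := hU
      · exact ⟨hv, hUX ▸ recF hv (by simpa using ha), hUZ ▸ recorded_none _ _ _,
          .inr (.inl ⟨hδ, hΔ ▸ hd, ha, hUX, hZo⟩)⟩
      · exact ⟨hh.toValid, hUX ▸ recF hh.toValid (by simpa using ha), hUZ ▸ recorded_none _ _ _,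
          .inl ⟨hh.pos, hitP hh⟩⟩
    · have e : case3 P B σ Z = upBranch P B σ (f7 P B (σ.cur P) σ.F Z) (f8 P B (σ.cur P) σ.F Z)
          (some Z) none := rfl
      change BranchOK P B (case3 P B σ Z) _
      rw [e]
      obtain ⟨hZm, hZs, hZt⟩ := hZ Z hZo
      have hb : al P B Z - be P B Z < 0 := by linarith
      have hv0 := htight Z hZt
      have hp0 : 0 < al P B σ.F := by linarith
      have hp' := al_nonneg (P := P) (B := B) Z
      have hφ : 0 < al P B σ.F * -(al P B Z - be P B Z) +
          al P B Z * (al P B σ.F - be P B σ.F) :=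
        add_pos_of_pos_of_nonneg (mul_pos hp0 (by linarith)) (mul_nonneg hp' ha.le)
      have e7 : f7 P B (σ.cur P) σ.F Z = (σ.viol P σ.F / (al P B σ.F - be P B σ.F) -
          σ.viol P Z / (al P B Z - be P B Z)) / (al P B σ.F / (al P B σ.F - be P B σ.F) -
            al P B Z / (al P B Z - be P B Z)) := by
        simp only [f7, State.viol, mu_sub_mu]
        rfl
      have e8 : f8 P B (σ.cur P) σ.F Z = (σ.viol P σ.F - f7 P B (σ.cur P) σ.F Z * al P B σ.F) /
          (al P B σ.F - be P B σ.F) := by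
        simp only [f8, State.viol, mu_sub_mu]
        rfl
      obtain ⟨m1, m2, m3, -⟩ := meet_eq ha hb hφ e7
      rw [← e8] at m2 m3
      generalize f7 P B (σ.cur P) σ.F Z = δ at *
      generalize f8 P B (σ.cur P) σ.F Z = Δ at *
      rw [hv0] at m1 m3
      -- As `Z` is tight, `m1` makes `δ` a positive multiple of the violation of `σ.F`.
      have hδ : 0 < δ := by
        refine pos_of_mul_pos_left ?_ hφ.le
        rw [m1]
        nlinarith
      have hΔ : 0 ≤ Δ := by
        by_contra hneg
        nlinarith [mul_pos_of_neg_of_neg (not_le.1 hneg) hb, mul_nonneg hδ.le hp']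
      have hval : (σ.d + δ) * (al P B σ.F * -(al P B Z - be P B Z) +
          al P B Z * (al P B σ.F - be P B σ.F)) =
          -(al P B Z - be P B Z) * gap P σ.F + (al P B σ.F - be P B σ.F) * gap P Z := by
        linear_combination m1 - (al P B Z - be P B Z) * V.eq - (al P B σ.F - be P B σ.F) * hZt
      have hlow' : ∀ x y, FeasPair P B x y → σ.d + δ ≤ max x 0 := by
        intro x y h
        -- Weighting the constraint of `σ.F` by `be - al` of `Z`, and that of `Z` by `al - be` of
        -- `σ.F`, eliminates `y`.
        refine le_max_of_le_left (le_of_mul_le_mul_right ?_ hφ)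
        nlinarith [mul_le_mul_of_nonneg_left (h.le _ V.mem) (neg_nonneg.2 hb.le),
          mul_le_mul_of_nonneg_left (h.le _ hZm.mem) ha.le]
      refine (upBranch_ok hB V ha hδ.le hΔ (by rw [m2, add_sub_cancel]) hlow' _ _).mono fun U hU => ?_
      obtain ⟨hUX, ⟨hUZ, hδ', hΔ', hv⟩ | ⟨hUZ, hh⟩⟩ := hU
      · refine ⟨hv, hUX ▸ recF hv (by simpa using ha), ?_, .inl ⟨hδ' ▸ hδ, .inr
          ⟨σ.F, Z, hF, hZm, ha, hb, ?_⟩⟩⟩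
        · rw [hUZ]
          intro Z' hZ'
          obtain rfl : Z = Z' := by simpa using hZ'
          refine ⟨hZm, hZs, ?_⟩
          rw [hδ', hΔ']
          linear_combination hZt - m3
        · rw [hδ', pairVal, ← neg_sub (al P B Z), eq_div_iff hφ.ne', hval]
      · exact ⟨hh.toValid, hUX ▸ recF hh.toValid (by simpa using ha), hUZ ▸ recorded_none _ _ _,
          .inl ⟨hh.pos, hitP hh⟩⟩
  · have ha : al P B σ.F - be P B σ.F < 0 := by
      rcases lt_trichotomy (mu P B σ.F) (mu P B P.Fs) with h | h | h
      · exact (h2 h).elim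
      · exact (h1 h).elim
      · linarith
    have ha' : 0 < -1 * (al P B σ.F - be P B σ.F) := by linarith
    rcases hXo : σ.X with _ | X
    · have e : case4 P B σ = downBranch P B σ 0 (f3 P B (σ.cur P) σ.F) σ.X σ.X := by
        simp only [case4, downBranch, add_zero]
      have hd := div_neg_of_pos_of_neg hpos ha
      simp only [e, e3, hXo]
      refine (downBranch_ok hB V ha le_rfl hd.le (by simpa using hd.le) (by
        rw [zero_mul, zero_add, div_mul_cancel₀ _ ha.ne]) (by simpa using hlow) _ _).mono
        fun U hU => ?_
      obtain ⟨hUZ, ⟨hUX, hδ, hΔ, hv⟩ | ⟨hUX, hh⟩⟩ := hU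
      · exact ⟨hv, hUX ▸ recorded_none _ _ _, hUZ ▸ recF hv ha',
          .inr (.inr ⟨hδ, hΔ ▸ hd, ha, hUZ, hUX, hXo⟩)⟩
      · exact ⟨hh.toValid, hUX ▸ recorded_none _ _ _, hUZ ▸ recF hh.toValid ha',
          .inl ⟨hh.pos, hitP hh⟩⟩
    · have e : case5 P B σ X = downBranch P B σ (f7 P B (σ.cur P) X σ.F)
          (f12 P B (σ.cur P) X σ.F) (some X) none := rfl
      change BranchOK P B (case5 P B σ X) _
      rw [e]
      obtain ⟨hXm, hXs, hXt⟩ := hX X hXo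
      rw [one_mul] at hXs
      have hv0 := htight X hXt
      have hq := be_nonneg (P := P) (B := B) X
      have hp0 : 0 < al P B X := by linarith
      have hφ : 0 < al P B X * -(al P B σ.F - be P B σ.F) +
          al P B σ.F * (al P B X - be P B X) :=
        add_pos_of_pos_of_nonneg (mul_pos hp0 (by linarith)) (mul_nonneg hal hXs.le)
      have e7 : f7 P B (σ.cur P) X σ.F = (σ.viol P X / (al P B X - be P B X) -
          σ.viol P σ.F / (al P B σ.F - be P B σ.F)) / (al P B X / (al P B X - be P B X) -
            al P B σ.F / (al P B σ.F - be P B σ.F)) := by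
        simp only [f7, State.viol, mu_sub_mu]
        rfl
      have e12 : f12 P B (σ.cur P) X σ.F = (σ.viol P σ.F - f7 P B (σ.cur P) X σ.F * al P B σ.F) /
          (al P B σ.F - be P B σ.F) := by
        simp only [f12, State.viol, mu_sub_mu]
        rfl
      obtain ⟨m1, m2, m3, m4⟩ := meet_eq hXs ha hφ e7
      rw [← m4, ← e12] at m2 m3
      generalize f7 P B (σ.cur P) X σ.F = δ at *
      generalize f12 P B (σ.cur P) X σ.F = Δ at *
      rw [hv0] at m1 m2
      have hδ : 0 < δ := by
        refine pos_of_mul_pos_left ?_ hφ.le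
        rw [m1]
        nlinarith
      have hΔ : Δ ≤ 0 := by
        by_contra hneg
        nlinarith [mul_pos (not_le.1 hneg) hXs, mul_pos hδ hp0]
      -- Moving along the line of `X` means `(δ + Δ) * (al - be) + δ * be = 0`, with `al` and `be`
      -- taken at `X`.
      have hδΔ : δ + Δ ≤ 0 := by
        by_contra hneg
        nlinarith [mul_pos (not_le.1 hneg) hXs, mul_nonneg hδ.le hq]
      have hval : (σ.d + δ) * (al P B X * -(al P B σ.F - be P B σ.F) +
          al P B σ.F * (al P B X - be P B X)) =
          -(al P B σ.F - be P B σ.F) * gap P X + (al P B X - be P B X) * gap P σ.F := by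
        linear_combination m1 + (al P B X - be P B X) * V.eq + (al P B σ.F - be P B σ.F) * hXt
      have hlow' : ∀ x y, FeasPair P B x y → σ.d + δ ≤ max x 0 := by
        intro x y h
        refine le_max_of_le_left (le_of_mul_le_mul_right ?_ hφ)
        nlinarith [mul_le_mul_of_nonneg_left (h.le _ V.mem) hXs.le,
          mul_le_mul_of_nonneg_left (h.le _ hXm.mem) (neg_nonneg.2 ha.le)]
      refine (downBranch_ok hB V ha hδ.le hΔ hδΔ m3 hlow' _ _).mono fun U hU => ?_
      obtain ⟨hUZ, ⟨hUX, hδ', hΔ', hv⟩ | ⟨hUX, hh⟩⟩ := hU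
      · refine ⟨hv, ?_, hUZ ▸ recF hv ha', .inl ⟨hδ' ▸ hδ, .inr
          ⟨X, σ.F, hXm, hF, hXs, ha, ?_⟩⟩⟩
        · rw [hUX]
          intro X' hX'
          obtain rfl : X = X' := by simpa using hX'
          refine ⟨hXm, by simpa using hXs, ?_⟩
          rw [hδ', hΔ']
          linear_combination hXt - m2
        · rw [hδ', pairVal, ← neg_sub (al P B σ.F), eq_div_iff hφ.ne', hval]
      · exact ⟨hh.toValid, hUX ▸ recorded_none _ _ _, hUZ ▸ recF hh.toValid ha',
          .inl ⟨hh.pos, hitP hh⟩⟩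

end Iteration

/-! ### Counting the values still ahead. -/

section Potential

/-- The number of indices `k` such that some element of `V k` exceeds `x`. -/
noncomputable def countAbove {K : Type*} (V : K → Set ℝ) (x : ℝ) : ℕ :=
  {k | ∃ v ∈ V k, x < v}.ncard

variable {K : Type*} [Finite K] (V : K → Set ℝ)

theorem countAbove_le (x : ℝ) : countAbove V x ≤ Nat.card K :=
  Set.ncard_le_card _

/-- The index `k` counts at `x` because of `y`, but no longer at `y`, the greatest element of `V k`.
-/
theorem countAbove_lt {x y : ℝ} (h : x < y) {k : K} (hk : IsGreatest (V k) y) :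
    countAbove V y < countAbove V x := by
  refine Set.ncard_lt_ncard ⟨fun j ⟨v, hv, hyv⟩ => ⟨v, hv, h.trans hyv⟩, fun hs => ?_⟩
    (Set.toFinite _)
  obtain ⟨v, hv, hyv⟩ := hs (show k ∈ {k | ∃ v ∈ V k, x < v} from ⟨y, hk.1, h⟩)
  exact hyv.not_ge (hk.2 hv)

end Potential

/-! ### Classes of sets and the potential. -/

section Classes

variable {S : Type*} [DecidableEq S] (P : Problem S) (B : Spec S) (W : ℕ)

/-- The members of `𝓕` with given values of `α` and `β`. -/
def classOf (n : Fin (W + 1) × Fin (W + 1)) : Set (Finset S) :=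
  {F | F ∈ P.𝓕 ∧ al P B F = (n.1 : ℕ) ∧ be P B F = (n.2 : ℕ)}

/-- The possible values of `d` when the constraint of a member of a class meets a bound constraint,
or when the constraints of members of two classes meet. -/
noncomputable def meetVals : (Fin 4 × (Fin (W + 1) × Fin (W + 1))) ⊕
    ((Fin (W + 1) × Fin (W + 1)) × (Fin (W + 1) × Fin (W + 1))) → Set ℝ
  | .inl (i, n) => (fun F => lineVal B i (al P B F) (be P B F) (gap P F)) '' classOf P B W n
  | .inr (n, m) => Set.image2 (fun X Z => pairVal (al P B X) (be P B X) (gap P X)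
      (al P B Z) (be P B Z) (gap P Z)) (classOf P B W n) (classOf P B W m)

/-- The values `ε D` for which the constraint of a member of a class is tight. -/
noncomputable def tightVals (d ε : ℝ) (n : Fin (W + 1) × Fin (W + 1)) : Set ℝ :=
  (fun F => ε * ((gap P F - d * al P B F) / (al P B F - be P B F))) '' classOf P B W n

variable {P B W}

theorem IsClassMax.exists_classOf (hW : ∀ X : Finset S, ∃ n : ℕ, n ≤ W ∧ mu P B X = n)
    {F : Finset S} (hF : IsClassMax P B F) :
    ∃ n, F ∈ classOf P B W n ∧ ∀ F' ∈ classOf P B W n,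
      al P B F' = al P B F ∧ be P B F' = be P B F ∧ gap P F' ≤ gap P F := by
  obtain ⟨p, hp, hp'⟩ := hW (P.Fs \ F)
  obtain ⟨q, hq, hq'⟩ := hW (F \ P.Fs)
  have h1 : al P B F = p := hp'
  have h2 : be P B F = q := hq'
  refine ⟨⟨⟨p, by omega⟩, ⟨q, by omega⟩⟩, ⟨hF.mem, h1, h2⟩, fun F' hF' => ?_⟩
  have e1 := hF'.2.1.trans h1.symm
  have e2 := hF'.2.2.trans h2.symm
  exact ⟨e1, e2, hF.le F' hF'.1 e1 e2⟩

omit [DecidableEq S] in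
theorem lineVal_mono (i : Fin 4) {p q g g' : ℝ} (hp : 0 ≤ p) (hq : 0 ≤ q) (h : g ≤ g') :
    lineVal B i p q g ≤ lineVal B i p q g' := by
  fin_cases i <;> exact div_le_div_of_nonneg_right (sub_le_sub_right h _) (by assumption)

/-- For fixed `al` and `be` both formulas are nondecreasing in the gaps, so maximal gaps give
maximal values. Zero denominators do no harm, as the quotient is then `0`. -/
theorem Progress.exists_isGreatest (hW : ∀ X : Finset S, ∃ n : ℕ, n ≤ W ∧ mu P B X = n)
    {x : ℝ} (h : Progress P B x) : ∃ k, IsGreatest (meetVals P B W k) x := by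
  obtain ⟨F, i, hF, rfl⟩ | ⟨X, Z, hX, hZ, ha, hb, rfl⟩ := h
  · obtain ⟨n, hn, hmax⟩ := hF.exists_classOf hW
    refine ⟨.inl (i, n), ⟨F, hn, rfl⟩, ?_⟩
    rintro _ ⟨F', hF', rfl⟩
    obtain ⟨h1, h2, h3⟩ := hmax F' hF'
    simp only [h1, h2]
    exact lineVal_mono i (al_nonneg F) (be_nonneg F) h3
  · obtain ⟨n, hn, hmax⟩ := hX.exists_classOf hW
    obtain ⟨m, hm, hmax'⟩ := hZ.exists_classOf hW
    refine ⟨.inr (n, m), ⟨X, hn, Z, hm, rfl⟩, ?_⟩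
    rintro _ ⟨X', hX', Z', hZ', rfl⟩
    obtain ⟨h1, h2, h3⟩ := hmax X' hX'
    obtain ⟨h4, h5, h6⟩ := hmax' Z' hZ'
    simp only [h1, h2, h4, h5, pairVal]
    have hb' : 0 ≤ be P B Z - al P B Z := by linarith
    refine div_le_div_of_nonneg_right (add_le_add (mul_le_mul_of_nonneg_left h3 hb')
      (mul_le_mul_of_nonneg_left h6 ha.le)) ?_
    exact add_nonneg (mul_nonneg (al_nonneg X) hb') (mul_nonneg (al_nonneg Z) ha.le)

/-- At fixed `d` the height of the line is monotone in the gap, in the direction given by the sign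
of `al - be`; the factor `ε` makes it increasing in both cases. -/
theorem IsClassMax.isGreatest_tightVals (hW : ∀ X : Finset S, ∃ n : ℕ, n ≤ W ∧ mu P B X = n)
    {F : Finset S} (hF : IsClassMax P B F) {d D ε : ℝ} (hε : 0 < ε * (al P B F - be P B F))
    (ht : gap P F = d * al P B F + D * (al P B F - be P B F)) :
    ∃ n, IsGreatest (tightVals P B W d ε n) (ε * D) := by
  obtain ⟨n, hn, hmax⟩ := hF.exists_classOf hW
  have ha : al P B F - be P B F ≠ 0 := right_ne_zero_of_mul hε.ne'
  refine ⟨n, ⟨F, hn, ?_⟩, ?_⟩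
  · dsimp only
    rw [ht, add_sub_cancel_left, mul_div_cancel_right₀ _ ha]
  · rintro _ ⟨F', hF', rfl⟩
    obtain ⟨h1, h2, h3⟩ := hmax F' hF'
    simp only [h1, h2]
    have h4 : D = (gap P F - d * al P B F) / (al P B F - be P B F) := by
      rw [ht, add_sub_cancel_left, mul_div_cancel_right₀ _ ha]
    have h5 : 0 ≤ ε / (al P B F - be P B F) := by
      have := div_nonneg hε.le (sq_nonneg (al P B F - be P B F))
      rwa [sq, mul_div_mul_right _ _ ha] at this
    rw [h4, ← sub_nonneg]
    calc 0 ≤ ε / (al P B F - be P B F) * (gap P F - gap P F') := mul_nonneg h5 (sub_nonneg.2 h3)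
      _ = _ := by ring

variable (P B W)

/-- The secondary potential, which bounds the number of iterations with constant `d`. -/
noncomputable def subPotential (d D : ℝ) : Option (Finset S) → Option (Finset S) → ℕ
  | some _, _ => countAbove (tightVals P B W d 1) (1 * D)
  | none, some _ => countAbove (tightVals P B W d (-1)) (-1 * D)
  | none, none => (W + 1) ^ 2 + 1

/-- The potential, which decreases in every iteration. -/
noncomputable def potential (d D : ℝ) (X Z : Option (Finset S)) : ℕ :=
  countAbove (meetVals P B W) d * ((W + 1) ^ 2 + 2) + subPotential P B W d D X Z

variable {P B W}

theorem countAbove_tightVals_le (d ε x : ℝ) :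
    countAbove (tightVals P B W d ε) x ≤ (W + 1) ^ 2 := by
  refine (countAbove_le _ _).trans ?_
  simp [Nat.card_eq_fintype_card, sq]

theorem subPotential_le (d D : ℝ) (X Z : Option (Finset S)) :
    subPotential P B W d D X Z ≤ (W + 1) ^ 2 + 1 := by
  rcases X with _ | X <;> rcases Z with _ | Z
  · exact le_rfl
  all_goals exact (countAbove_tightVals_le _ _ _).trans (Nat.le_succ _)

/-- The extra `1` pays for the oracle call made at initialization. -/
theorem potential_le (hW1 : 1 ≤ W) (d D : ℝ) (X Z : Option (Finset S)) :
    potential P B W d D X Z + 1 ≤ 200 * W ^ 6 := by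
  have h1 : countAbove (meetVals P B W) d ≤ 4 * (W + 1) ^ 2 + ((W + 1) ^ 2) ^ 2 := by
    refine (countAbove_le _ _).trans ?_
    simp [Nat.card_eq_fintype_card, sq]
  have h2 := subPotential_le (P := P) (B := B) (W := W) d D X Z
  have h3 : (W + 1) ^ 2 ≤ 4 * W ^ 2 := by nlinarith
  have h4 : 1 ≤ W ^ 2 := Nat.one_le_pow _ _ hW1
  have h6 : W ^ 6 = (W ^ 2) ^ 3 := by ring
  rw [potential, h6]
  generalize (W + 1) ^ 2 = M at *
  generalize W ^ 2 = Q at *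
  -- From `M ≤ 4 * Q` and `1 ≤ Q`. The product in `h8` is then at most `192 * Q ^ 3`, and the
  -- secondary part adds at most `6 * Q`.
  have h7 : 4 * M + M ^ 2 ≤ 32 * Q ^ 2 := by nlinarith
  have h8 := Nat.mul_le_mul (h1.trans h7) (show M + 2 ≤ 6 * Q by linarith)
  have h9 : Q ≤ Q ^ 3 := Nat.le_self_pow (by norm_num) _
  have h10 : 32 * Q ^ 2 * (6 * Q) = 192 * Q ^ 3 := by ring
  omega

/-- The factor `(W + 1) ^ 2 + 2` exceeds every `subPotential`, so an increase of `d` outweighs any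
change there. A step with constant `d` either makes the first record, leaving the top value `(W + 1)
^ 2 + 1`, or continues in the direction of the existing record and uses up a class. -/
theorem StepOK.potential_lt (hW : ∀ X : Finset S, ∃ n : ℕ, n ≤ W ∧ mu P B X = n)
    {σ : State S} {U : Update S} (h : StepOK P B σ U) (hF : IsClassMax P B σ.F) :
    potential P B W (σ.d + U.δ) (σ.D + U.Δ) U.X U.Z < potential P B W σ.d σ.D σ.X σ.Z := by
  obtain ⟨hδ, hp⟩ | ⟨hδ, hΔ, ha, hX, hZ⟩ | ⟨hδ, hΔ, ha, hZ, hX, hX'⟩ := h.progress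
  · obtain ⟨k, hk⟩ := hp.exists_isGreatest hW
    have h1 := countAbove_lt (meetVals P B W) (show σ.d < σ.d + U.δ by linarith) hk
    have h2 := subPotential_le (P := P) (B := B) (W := W) (σ.d + U.δ) (σ.D + U.Δ) U.X U.Z
    have h3 := Nat.mul_le_mul_right ((W + 1) ^ 2 + 2) (Nat.succ_le_of_lt h1)
    rw [Nat.succ_mul] at h3
    unfold potential
    omega
  · have ht := h.valid.tight
    rw [hδ, add_zero] at ht ⊢
    unfold potential
    rw [hX, hZ, add_lt_add_iff_left]
    rcases σ.X with _ | X
    · exact Nat.lt_succ_of_le (countAbove_tightVals_le _ _ _)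
    · obtain ⟨n, hn⟩ := hF.isGreatest_tightVals hW (by rwa [one_mul]) ht
      exact countAbove_lt _ (by linarith) hn
  · have ht := h.valid.tight
    rw [hδ, add_zero] at ht ⊢
    unfold potential
    rw [hX, hZ, hX', add_lt_add_iff_left]
    rcases σ.Z with _ | Z
    · exact Nat.lt_succ_of_le (countAbove_tightVals_le _ _ _)
    · obtain ⟨n, hn⟩ := hF.isGreatest_tightVals (ε := -1) hW (by linarith) ht
      exact countAbove_lt _ (by linarith) hn

end Classes

/-! ### Loop invariant, termination and initialization. -/

section Main

variable {S : Type*} [Fintype S] [DecidableEq S] {P : Problem S} {B : Spec S}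
  {O : (S → ℝ) → Finset S}

/-- The invariant of the loop. -/
structure Inv (P : Problem S) (B : Spec S) (O : (S → ℝ) → Finset S) (σ : State S) : Prop where
  F_eq : σ.F = O (σ.cur P)
  inb : InBounds B σ.d σ.D
  d_nonneg : 0 ≤ σ.d
  lower : ∀ x y, FeasPair P B x y → σ.d ≤ max x 0
  recX : Recorded P B σ.d σ.D 1 σ.X
  recZ : Recorded P B σ.d σ.D (-1) σ.Z

/-- The correctness of an outcome. -/
inductive Correct [Nonempty S] (P : Problem S) : Outcome S → Prop
  | infeasible (h : ¬ ∃ p : S → ℝ, P.IsFeasible p) : Correct P .infeasible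
  | vector (d D : ℝ) (h : P.IsOptimal (P.dev d D)) : Correct P (.vector (P.dev d D))

omit [Fintype S] in
theorem next_running_of_none {σ : State S} (h : cost (σ.cur P) σ.F < cost (σ.cur P) P.Fs)
    (hb : body P B σ = none) : next P B O (.running σ) = .halted .infeasible σ.calls := by
  simp only [next, if_pos h, hb]

omit [Fintype S] in
theorem next_running_of_some {σ : State S} (h : cost (σ.cur P) σ.F < cost (σ.cur P) P.Fs)
    {U : Update S} (hb : body P B σ = some U) : next P B O (.running σ) =
      .running ⟨σ.d + U.δ, σ.D + U.Δ, U.X, U.Y, U.Z,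
        O (P.c - P.dev (σ.d + U.δ) (σ.D + U.Δ)), σ.calls + 1⟩ := by
  simp only [next, if_pos h, hb, enter]

omit [Fintype S] in
theorem next_running_of_not_lt {σ : State S} (h : ¬ cost (σ.cur P) σ.F < cost (σ.cur P) P.Fs) :
    next P B O (.running σ) = .halted (.vector (P.dev σ.d σ.D)) σ.calls := by
  simp only [next, if_neg h]

theorem next_running [Nonempty S] {W : ℕ} (hB : P.IsSpecLU B) (hO : P.IsOracle O)
    (hW : ∀ X : Finset S, ∃ n : ℕ, n ≤ W ∧ mu P B X = n) {σ : State S} (h : Inv P B O σ) :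
    (∃ o, next P B O (.running σ) = .halted o σ.calls ∧ Correct P o) ∨
      ∃ σ', next P B O (.running σ) = .running σ' ∧ Inv P B O σ' ∧ σ'.calls = σ.calls + 1 ∧
        potential P B W σ'.d σ'.D σ'.X σ'.Z < potential P B W σ.d σ.D σ.X σ.Z := by
  have hv : ∀ G, σ.viol P G =
      gap P G - σ.d * al P B G - σ.D * (al P B G - be P B G) := violation_eq hB h.inb
  have hmem : σ.F ∈ P.𝓕 := h.F_eq ▸ (hO (σ.cur P)).1
  have hmin : ∀ G ∈ P.𝓕, σ.viol P G ≤ σ.viol P σ.F := fun G hG => by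
    have := (hO (σ.cur P)).2 G hG
    rw [← h.F_eq] at this
    exact sub_le_sub_left this _
  -- Within a class, violation and gap differ by a constant, and the oracle's answer maximizes the
  -- violation.
  have hF : IsClassMax P B σ.F := ⟨hmem, fun G hG h1 h2 => by
    have h3 := hmin G hG
    rw [hv, hv, h1, h2] at h3
    linarith⟩
  by_cases hlt : cost (σ.cur P) σ.F < cost (σ.cur P) P.Fs
  · have V : Violated P B σ := ⟨h.inb, hmem, sub_pos.2 hlt, hv _⟩
    obtain ⟨hb, hn⟩ | ⟨U, hb, hU⟩ := body_ok hB V hF h.lower h.recX h.recZ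
      fun G hG => by rw [hv, hG]; ring
    · refine .inl ⟨.infeasible, next_running_of_none hlt hb, .infeasible ?_⟩
      rintro ⟨q, hq⟩
      obtain ⟨x, y, hxy, -⟩ := hq.exists_feasPair hB h.inb
      exact hn x y hxy
    · refine .inr ⟨_, next_running_of_some hlt hb, ⟨rfl, hU.valid.inb, ?_, hU.valid.lower, hU.recX, hU.recZ⟩,
        rfl, hU.potential_lt hW hF⟩
      have h1 := h.d_nonneg
      have h2 : 0 ≤ U.δ := by
        obtain h2 | h2 | h2 := hU.progress
        · exact h2.1.le
        · exact h2.1.ge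
        · exact h2.1.ge
      exact add_nonneg h1 h2
  · refine .inl ⟨_, next_running_of_not_lt hlt,
      .vector _ _ (isOptimal_dev hB ⟨h.inb, fun G hG => ?_⟩ h.d_nonneg h.lower)⟩
    have h1 := hmin G hG
    have h2 : σ.viol P σ.F ≤ 0 := sub_nonpos.2 (not_lt.1 hlt)
    rw [hv] at h1
    linarith

/-- Each further oracle call costs at least one unit of potential, so the potential bounds the
remaining calls. -/
theorem exists_iterate_eq_halted [Nonempty S] {W : ℕ} (hB : P.IsSpecLU B) (hO : P.IsOracle O)
    (hW : ∀ X : Finset S, ∃ n : ℕ, n ≤ W ∧ mu P B X = n) (m : ℕ) :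
    ∀ σ : State S, Inv P B O σ → potential P B W σ.d σ.D σ.X σ.Z ≤ m →
      ∃ o N n, (next P B O)^[n] (.running σ) = .halted o N ∧ N ≤ σ.calls + m ∧ Correct P o := by
  induction m with
  | zero =>
    intro σ h hm
    obtain ⟨o, h1, h2⟩ | ⟨σ', -, -, -, h4⟩ := next_running hB hO hW h
    · exact ⟨o, _, 1, h1, le_rfl, h2⟩
    · omega
  | succ m ih =>
    intro σ h hm
    obtain ⟨o, h1, h2⟩ | ⟨σ', h1, h2, h3, h4⟩ := next_running hB hO hW h
    · exact ⟨o, _, 1, h1, Nat.le_add_right _ _, h2⟩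
    · obtain ⟨o, N, n, h5, h6, h7⟩ := ih σ' h2 (by omega)
      exact ⟨o, N, n + 1, by rw [Function.iterate_succ_apply, h1, h5], by omega, h7⟩

-- A nonzero start `l - u` is forced on every feasible pair by `l ≤ x + y` and `y ≤ u`. The start is
-- admissible because the in-bounds dominate the out-bounds.
omit [Fintype S] in
theorem initial_parameters (hB : P.IsSpecLU B) :
    InBounds B (d₀ B) (D₀ B) ∧ 0 ≤ d₀ B ∧ (d₀ B = 0 ∨ ∃ l u : ℝ, B.ℓin = l ∧ B.uout = u ∧
      d₀ B = l - u) := by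
  have h1 := hB.in_le
  have h2 := hB.out_le
  have h3 := hB.ℓout_le_ℓin
  have h4 := hB.uout_le_uin
  by_cases hu : B.uout = ⊤
  · have hd : d₀ B = 0 := by simp [d₀, hu]
    have hui : B.uin = ⊤ := top_le_iff.1 (hu ▸ h4)
    have hD : B.ℓin ≤ ((D₀ B : ℝ) : EReal) := by
      by_cases hl : B.ℓin = ⊥
      · simp [hl]
      · simp only [D₀, hu, ne_eq, not_true, if_false, hl, not_false_eq_true, if_true]
        rw [EReal.coe_toReal hB.ℓin_ne_top hl]
    exact ⟨⟨by rwa [hd, zero_add], by simp [hui], h3.trans hD, by simp [hu]⟩, hd.ge, .inl hd⟩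
  · have hD : D₀ B = B.uout.toReal := by simp [D₀, hu]
    have hu' : ((D₀ B : ℝ) : EReal) = B.uout := by rw [hD, EReal.coe_toReal hu hB.uout_ne_bot]
    by_cases hl : B.ℓin = ⊥
    · have hd : d₀ B = 0 := by simp [d₀, hl]
      refine ⟨⟨by simp [hl], ?_, by rwa [hu'], hu'.le⟩, hd.ge, .inl hd⟩
      rwa [hd, zero_add, hu']
    · have hl' := EReal.coe_toReal hB.ℓin_ne_top hl
      have hd : d₀ B = max (B.ℓin.toReal - D₀ B) 0 := by
        have e : B.ℓin - B.uout = ((B.ℓin.toReal - D₀ B : ℝ) : EReal) := by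
          rw [EReal.coe_sub, hl', hu']
        rw [d₀, e, ← EReal.coe_zero]
        rcases le_total (B.ℓin.toReal - D₀ B) 0 with h | h
        · rw [max_eq_right h, max_eq_right (EReal.coe_le_coe_iff.2 h), EReal.toReal_coe]
        · rw [max_eq_left h, max_eq_left (EReal.coe_le_coe_iff.2 h), EReal.toReal_coe]
      rw [hd]
      rcases le_total (B.ℓin.toReal - D₀ B) 0 with h | h
      · rw [max_eq_right h]
        refine ⟨⟨?_, ?_, by rwa [hu'], hu'.le⟩, le_rfl, .inl rfl⟩
        · rw [zero_add, ← hl', EReal.coe_le_coe_iff]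
          linarith
        · rwa [zero_add, hu']
      · rw [max_eq_left h]
        refine ⟨⟨?_, ?_, by rwa [hu'], hu'.le⟩, h, .inr ⟨_, _, hl'.symm, hu'.symm, rfl⟩⟩
        · rw [sub_add_cancel, hl']
        · rwa [sub_add_cancel, hl']

omit [Fintype S] in
theorem inv_init (hB : P.IsSpecLU B) :
    Inv P B O ⟨d₀ B, D₀ B, none, none, none, O (P.c - P.dev (d₀ B) (D₀ B)), 1⟩ := by
  obtain ⟨h1, h2, h3⟩ := initial_parameters hB
  refine ⟨rfl, h1, h2, fun x y hxy => ?_, recorded_none _ _ _, recorded_none _ _ _⟩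
  obtain h3 | ⟨l, u, hl, hu, h3⟩ := h3
  · exact le_max_of_le_right h3.le
  · refine le_max_of_le_left ?_
    have h4 := hxy.lin
    have h5 := hxy.uout
    rw [hl, EReal.coe_le_coe_iff] at h4
    rw [hu, EReal.coe_le_coe_iff] at h5
    dsimp only
    linarith

end Main

end InvSpan

theorem mainTheorem1 :
    ∃ C : ℝ, ∀ (S : Type*) [Fintype S] [DecidableEq S] [Nonempty S]
      (P : InvSpan.Problem S) (B : InvSpan.Spec S) (O : (S → ℝ) → Finset S),
      P.IntegralWeights → P.IsSpecLU B → P.IsOracle O →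
      ∃ (o : InvSpan.Outcome S) (N : ℕ),
        InvSpan.Returns P B O o N ∧ (N : ℝ) ≤ C * P.wNegOne ^ 6 ∧
        match o with
        | .infeasible => ¬ ∃ p : S → ℝ, P.IsFeasible p
        | .vector p => P.IsOptimal p ∧ ∃ d D : ℝ, p = P.dev d D := by
  refine ⟨200, fun S _ _ _ P B O hw hB hO => ?_⟩
  obtain ⟨W, hW, hmu⟩ := InvSpan.exists_nat_mu (B := B) hw
  have hW1 : 1 ≤ W := by
    have := InvSpan.one_le_wNegOne hw
    rw [hW] at this
    exact_mod_cast this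
  obtain ⟨o, N, n, h1, h2, h3⟩ := InvSpan.exists_iterate_eq_halted hB hO hmu _ _
    (InvSpan.inv_init (O := O) hB) le_rfl
  refine ⟨o, N, ⟨n, h1⟩, ?_, ?_⟩
  swap
  · cases h3 with
    | infeasible h => exact h
    | vector d D h => exact ⟨h, d, D, rfl⟩
  have h4 := InvSpan.potential_le (P := P) (B := B) hW1 (InvSpan.d₀ B) (InvSpan.D₀ B) none none
  rw [hW]
  exact_mod_cast h2.trans ((Nat.add_comm _ _).le.trans h4)
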